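/- **Setting.** Let $1\le K\le N$, let $G\in\mathbb R^{N\times N}$ be a positive semidefinite (Gram) matrix whose principal submatrices $G_{S,S}$ are positive definite for all $S\in\mathcal A=\{S\subseteq[N]:|S|=K\}$, let $\varepsilon>0$, $c>0$ and $\alpha_1,\dots,\alpha_N\in[0,1]$. Put $$r(a)=2\big[a\log(1+\varepsilon)+(1-a)\log\varepsilon\big],\qquad f(S)=\log\det G_{S,S}+\sum_{i\in S}r(\alpha_i),\qquad A^\star\in\arg\max_{S\in\mathcal A}f(S),$$ $$\Delta_{\max}=\max_{S\in\mathcal A}\big(f(A^\star)-f(S)\big),\qquad \Delta_i=\min\{f(A^\star)-f(S): S\in\mathcal A,\ i\in S,\ f(S)<f(A^\star)\}\quad(\min\emptyset=+\infty),$$ $$\beta_\varepsilon=2\log\frac{1+\varepsilon}{\varepsilon},\qquad \alpha_i^+=\min\Big\{1,\ \alpha_i+\frac{\Delta_i}{K\beta_\varepsilon}\Big\},\qquad \mathrm{kl}(p\|q)=p\log\frac pq+(1-p)\log\frac{1-p}{1-q}\in[0,\infty],$$ with the usual conventions $0\log 0=0$ and $\mathrm{kl}(p\|q)=\infty$ if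 $q=0<p$ or $q=1>p$. **Algorithm (ProbDPP).** In each round $t=1,\dots,T$ the learner knows, for every item $i$, the number $n_i(t-1)$ of earlier rounds in which $i$ was selected and the empirical mean $\hat\alpha_i(t-1)$ of the outcomes of $i$ observed in them. It sets $U_i(t)=1$ if $n_i(t-1)=0$, and otherwise $$U_i(t)=\max\{u\in[0,1]: n_i(t-1)\,\mathrm{kl}(\hat\alpha_i(t-1)\|u)\le \log t+c\log\log t\}$$ (a negative right-hand side, possible only for $t=2$, is read as $0$). It then selects $$A_t\in\arg\max_{S\in\mathcal A}\Big\{\log\det G_{S,S}+\sum_{i\in S}r(U_i(t))\Big\},$$ with ties broken arbitrarily on the basis of the past (possibly at random), and observes $z_{i,t}$ for $i\in A_t$. Here $z_{i,t}\sim\mathrm{Bernoulli}(\alpha_i)$, the outcomes of a round being independent of each other and of everything known to the learner before that round. **Theorem (Regret of ProbDPP).** $\Delta_{\max}<\infty$, and there is a constant $C<\infty$, depending on $N,K,G,\varepsilon,c,\alpha$ but neither on $T$ nor on the tie-breaking, such that for all $T\ge3$ $$\mathbb E\Big[\sum_{t=1}^T\big(f(A^\star)-f(A_t)\big)\Big]\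 \le\ \Delta_{\max}\sum_{i=1}^N\frac{\log T+c\log\log T}{\mathrm{kl}(\alpha_i\|\alpha_i^+)}+C .$$ Here $x/\infty=0$, $x/0=\infty$ for $x>0$ (the denominator is $0$ only if $\alpha_i=1$), and $0\cdot\infty=0$. -/

import Mathlib

open MeasureTheory ProbabilityTheory
open scoped ENNReal NNReal

namespace ProbDPP

noncomputable section

/-! ### Bernoulli relative entropy and the reliability reward -/

/-- Relative entropy `kl(p ‖ q)` of two Bernoulli laws with parameters `p, q ∈ [0, 1]`, with values
in `[0, ∞]`.  The conventions are `0 log 0 = 0` and `kl(p ‖ q) = ∞` when `P_p` is not absolutely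
continuous with respect to `P_q`.  (The finite value is nonnegative, so `ofReal` loses nothing.) -/
def klBer (p q : ℝ) : ℝ≥0∞ :=
  if (q = 0 ∧ p ≠ 0) ∨ (q = 1 ∧ p ≠ 1) then ⊤
  else ENNReal.ofReal (p * Real.log (p / q) + (1 - p) * Real.log ((1 - p) / (1 - q)))

/-- The per-item reliability reward `r(a, ε) = 2 [a log (1 + ε) + (1 - a) log ε]`. -/
def relReward (ε a : ℝ) : ℝ := 2 * (a * Real.log (1 + ε) + (1 - a) * Real.log ε)

/-- The slope `β_ε = 2 log ((1 + ε) / ε)`. -/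
def slope (ε : ℝ) : ℝ := 2 * Real.log ((1 + ε) / ε)

/-! ### Actions, objective and gaps -/

section Objective

variable {N : ℕ}

/-- The actions: the subsets of the `N` items with exactly `K` elements. -/
def actions (N K : ℕ) : Finset (Finset (Fin N)) := Finset.powersetCard K Finset.univ

/-- The principal submatrix `G_{S,S}`. -/
def principal (G : Matrix (Fin N) (Fin N) ℝ) (S : Finset (Fin N)) : Matrix S S ℝ :=
  G.submatrix (fun i => (i : Fin N)) (fun i => (i : Fin N))

/-- The objective `log det G_{S,S} + ∑_{i ∈ S} r(w_i, ε)`.  At the true reliabilities `w = α` this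
is `f(S)`; at the optimistic indices it is what the algorithm maximizes. -/
def objective (G : Matrix (Fin N) (Fin N) ℝ) (ε : ℝ) (w : Fin N → ℝ) (S : Finset (Fin N)) : ℝ :=
  Real.log (principal G S).det + ∑ i ∈ S, relReward ε (w i)

/-- `S` maximizes the objective with weights `w` over the actions. -/
def IsArgmax (G : Matrix (Fin N) (Fin N) ℝ) (K : ℕ) (ε : ℝ) (w : Fin N → ℝ)
    (S : Finset (Fin N)) : Prop :=
  S ∈ actions N K ∧ ∀ S' ∈ actions N K, objective G ε w S' ≤ objective G ε w S

/-- The gap `f(A⋆) - f(S)`. -/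
def gap (G : Matrix (Fin N) (Fin N) ℝ) (ε : ℝ) (α : Fin N → ℝ) (Astar S : Finset (Fin N)) : ℝ :=
  objective G ε α Astar - objective G ε α S

/-- `Δ_max`, the largest gap of an action. -/
def maxGap (G : Matrix (Fin N) (Fin N) ℝ) (K : ℕ) (ε : ℝ) (α : Fin N → ℝ)
    (Astar : Finset (Fin N)) : ℝ≥0∞ :=
  ⨆ S ∈ actions N K, ENNReal.ofReal (gap G ε α Astar S)

/-- `Δ_i`, the smallest gap of a strictly suboptimal action that contains item `i`; it is `∞` (the
infimum over the empty set) if there is no such action. -/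
def itemGap (G : Matrix (Fin N) (Fin N) ℝ) (K : ℕ) (ε : ℝ) (α : Fin N → ℝ)
    (Astar : Finset (Fin N)) (i : Fin N) : ℝ≥0∞ :=
  ⨅ S ∈ {S ∈ actions N K | i ∈ S ∧ objective G ε α S < objective G ε α Astar},
    ENNReal.ofReal (gap G ε α Astar S)

/-- `α_i⁺ = min {1, α_i + Δ_i / (K β_ε)}`; it equals `1` if `Δ_i = ∞`. -/
def alphaPlus (G : Matrix (Fin N) (Fin N) ℝ) (K : ℕ) (ε : ℝ) (α : Fin N → ℝ)
    (Astar : Finset (Fin N)) (i : Fin N) : ℝ :=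
  (min 1 (ENNReal.ofReal (α i)
    + itemGap G K ε α Astar i / ENNReal.ofReal ((K : ℝ) * slope ε))).toReal

end Objective

/-! ### Statistics and the KL-UCB index, along one sequence of actions and outcomes -/

section Statistics

variable {N : ℕ}

/-- `n_i(t)`: how often item `i` was selected in rounds `1, …, t`. -/
def pulls (A : ℕ → Finset (Fin N)) (i : Fin N) (t : ℕ) : ℕ :=
  {s ∈ Finset.Icc 1 t | i ∈ A s}.card

/-- The number of observed successes of item `i` in rounds `1, …, t`. -/
def successes (A : ℕ → Finset (Fin N)) (z : ℕ → Fin N → Bool) (i : Fin N) (t : ℕ) : ℕ :=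
  {s ∈ Finset.Icc 1 t | i ∈ A s ∧ z s i = true}.card

/-- The empirical mean `α̂_i(t)`; it is `0` as long as item `i` has not been selected. -/
def empMean (A : ℕ → Finset (Fin N)) (z : ℕ → Fin N → Bool) (i : Fin N) (t : ℕ) : ℝ :=
  (successes A z i t : ℝ) / (pulls A i t : ℝ)

/-- The exploration level `log t + c log log t`. -/
def level (c : ℝ) (t : ℕ) : ℝ := Real.log t + c * Real.log (Real.log t)

/-- The KL-UCB index in round `t` of an item with `n` observations of mean `p`: the largest
`u ∈ [0, 1]` with `n kl(p ‖ u) ≤ log t + c log log t`, and `1` if `n = 0`.  If `n ≥ 1` and the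
level is negative (possible for `t = 2` only), no `u` satisfies the constraint as written; `ofReal`
replaces the level by `0` there, so that the index is `p`. -/
def klUCB (c : ℝ) (t n : ℕ) (p : ℝ) : ℝ :=
  if n = 0 then 1
  else sSup {u : ℝ | u ∈ Set.Icc (0 : ℝ) 1 ∧ (n : ℝ≥0∞) * klBer p u ≤ ENNReal.ofReal (level c t)}

/-- The index `U_i(t)` used in round `t ≥ 1`, computed from the data of rounds `1, …, t - 1`. -/
def index (c : ℝ) (A : ℕ → Finset (Fin N)) (z : ℕ → Fin N → Bool) (t : ℕ) (i : Fin N) : ℝ :=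
  klUCB c t (pulls A i (t - 1)) (empMean A z i (t - 1))

end Statistics

/-! ### Runs of the algorithm -/

/-- `A` is a run of the algorithm over the rounds `1, …, T` under semi-bandit feedback with
independent Bernoulli outcomes `z t i` of parameters `α i`.

`ℱ t` is the information the learner has after round `t`.  It contains the outcomes of the selected
items, and may contain more (such as a random seed for tie-breaking) as long as the outcomes of the
next round are independent of it.  Ties in the maximization may be broken in any way that is based
on this information. -/
structure IsRun {N : ℕ} {Ω : Type*} [mΩ : MeasurableSpace Ω] (μ : Measure Ω)
    (ℱ : Filtration ℕ mΩ)
    (G : Matrix (Fin N) (Fin N) ℝ) (K : ℕ) (ε c : ℝ) (α : Fin N → ℝ) (T : ℕ)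
    (z : ℕ → Fin N → Ω → Bool) (A : ℕ → Ω → Finset (Fin N)) : Prop where
  /-- outcomes are random variables -/
  measurable_outcome : ∀ t ∈ Finset.Icc 1 T, ∀ i, Measurable (z t i)
  /-- item `i` succeeds with probability `α i` -/
  bernoulli : ∀ t ∈ Finset.Icc 1 T, ∀ i, μ {ω | z t i ω = true} = ENNReal.ofReal (α i)
  /-- the outcomes of one round are independent of each other -/
  indep_items : ∀ t ∈ Finset.Icc 1 T, iIndepFun (z t) μ
  /-- the outcomes of round `t` are jointly independent of what is known before round `t` -/
  indep_past : ∀ t ∈ Finset.Icc 1 T,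
    Indep (MeasurableSpace.comap (fun ω i => z t i ω) inferInstance) (ℱ (t - 1)) μ
  /-- the action of round `t` is decided on what is known before round `t` -/
  predictable : ∀ t ∈ Finset.Icc 1 T, ∀ S, MeasurableSet[ℱ (t - 1)] {ω | A t ω = S}
  /-- after round `t` the outcomes of the selected items are known -/
  feedback : ∀ t ∈ Finset.Icc 1 T, ∀ i,
    MeasurableSet[ℱ t] {ω | i ∈ A t ω ∧ z t i ω = true}
  /-- the action of round `t` maximizes the objective at the KL-UCB indices -/
  optimistic : ∀ t ∈ Finset.Icc 1 T, ∀ ω,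
    IsArgmax G K ε (index c (fun s => A s ω) (fun s i => z s i ω) t) (A t ω)

/-- The pseudo-regret `∑_{t = 1}^T (f(A⋆) - f(A_t))` of one sequence of actions. -/
def regret {N : ℕ} (G : Matrix (Fin N) (Fin N) ℝ) (ε : ℝ) (α : Fin N → ℝ)
    (Astar : Finset (Fin N)) (T : ℕ) (A : ℕ → Finset (Fin N)) : ℝ :=
  ∑ t ∈ Finset.Icc 1 T, gap G ε α Astar (A t)

end

end ProbDPP

/-! A suboptimal round costs at most `maxGap`, so it suffices to count such rounds in expectation.
The objective is affine in the weights with the same slope for every item. Hence, if the indices of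
some optimal action are at least `α i - η`, a suboptimal maximizer contains an item `j` of index at
least `alphaPlus j - η` (`exists_alphaPlus_sub_le`). The round is charged to the success and failure
counts of `j`, a state that the pull leaves for good.

By Gibbs' inequality, an index above `v` keeps the log-likelihood walk `walk (α j) v`, whose drift
is `klReal (α j) v`, below the exploration level (`walk_le_of_klBer_le`). A walk of drift `μ > 0`
makes `L / μ + O(1)` expected visits below `L` (`occBound_renewal`). With `v` close to `alphaPlus j`
this is the leading term; if `alphaPlus j = 1`, only boundedly many visits are expected.

The indices of optimal items may fall short of the reliabilities, and for small `c` the usual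
confidence bound does not make this summable. Two stages avoid it. A shortfall by a fixed `δ` has
probability `O(t ^ (-(1 + γ)))` (`occBound_failSet`). Apart from such visits and other summably rare
ones, suboptimal rounds after `t / 4` are so few that some optimal action is played `√t` times
before round `t` (`exists_optimal_count`). The empirical means of its items, and so their indices,
then fall short by less than `η = t ^ (-1/8)`, again up to summable probability (`occBound_lowSet`).
This action is the comparator in round `t`, and since `η log t → 0` the slack costs only a constant.

Probability enters only through superharmonic functions of the counts. The counts of an item move
only when it is selected, and selection is predictable, so such a function is a supermartingale
along every run (`IsRun.lintegral_occ_le`). -/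

namespace ProbDPP

/-! ### Superharmonic bounds for the chain of success and failure counts -/

/-- `b` bounds the expected total of `ψ` over the states visited by the chain of success and
failure counts of a Bernoulli(`a`) sequence, as witnessed by a superharmonic function. -/
def OccBound (a : ℝ) (ψ : ℕ × ℕ → ℝ≥0∞) (b : ℝ≥0∞) : Prop :=
  ∃ φ : ℕ × ℕ → ℝ≥0∞, (∀ s f, ψ (s, f) + (ENNReal.ofReal a * φ (s + 1, f)
    + ENNReal.ofReal (1 - a) * φ (s, f + 1)) ≤ φ (s, f)) ∧ φ (0, 0) ≤ b

lemma OccBound.mono {a : ℝ} {ψ ψ' : ℕ × ℕ → ℝ≥0∞} {b b' : ℝ≥0∞} (h : OccBound a ψ b)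
    (hψ : ψ' ≤ ψ) (hb : b ≤ b') : OccBound a ψ' b' := by
  obtain ⟨φ, h1, h2⟩ := h
  exact ⟨φ, fun s f => (add_le_add_left (hψ (s, f)) _).trans (h1 s f), h2.trans hb⟩

lemma OccBound.add {a : ℝ} {ψ ψ' : ℕ × ℕ → ℝ≥0∞} {b b' : ℝ≥0∞} (h : OccBound a ψ b)
    (h' : OccBound a ψ' b') : OccBound a (ψ + ψ') (b + b') := by
  obtain ⟨φ, h1, h2⟩ := h
  obtain ⟨φ', h1', h2'⟩ := h'
  refine ⟨φ + φ', fun s f => ?_, add_le_add h2 h2'⟩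
  refine le_trans (le_of_eq ?_) (add_le_add (h1 s f) (h1' s f))
  simp only [Pi.add_apply]
  ring

lemma OccBound.tsum {ι : Type*} {a : ℝ} {ψ : ι → ℕ × ℕ → ℝ≥0∞} {b : ι → ℝ≥0∞}
    (h : ∀ k, OccBound a (ψ k) (b k)) :
    OccBound a (fun p => ∑' k, ψ k p) (∑' k, b k) := by
  choose φ h1 h2 using h
  refine ⟨fun p => ∑' k, φ k p, fun s f => ?_, ENNReal.tsum_le_tsum h2⟩
  simp only [← ENNReal.tsum_mul_left, ← ENNReal.tsum_add]
  exact ENNReal.tsum_le_tsum fun k => h1 k s f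

lemma OccBound.union {a : ℝ} {D E : Set (ℕ × ℕ)} {b b' : ℝ≥0∞}
    (h : OccBound a (D.indicator 1) b) (h' : OccBound a (E.indicator 1) b') :
    OccBound a ((D ∪ E).indicator 1) (b + b') := by
  refine (h.add h').mono (fun p => ?_) le_rfl
  by_cases hD : p ∈ D <;> by_cases hE : p ∈ E <;> simp [hD, hE]

/-- One step multiplies the weight by at most `r` on average, so the visits from `n₀` on sum to a
geometric series. The factor `r ^ (n₀ - n)`, with truncated subtraction, accounts for the uncharged
steps before `n₀`. -/
lemma occBound_geometric {a : ℝ} {x y r : ℝ≥0∞}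
    (hr : ENNReal.ofReal a * x + ENNReal.ofReal (1 - a) * y ≤ r) (hr1 : r < 1) (n₀ : ℕ) :
    OccBound a ({p | n₀ ≤ p.1 + p.2}.indicator fun p => x ^ p.1 * y ^ p.2)
      (r ^ n₀ * (1 - r)⁻¹) := by
  have hc : 1 + r * (1 - r)⁻¹ = (1 - r)⁻¹ := by
    have h1 : (1 - r) * (1 - r)⁻¹ = 1 :=
      ENNReal.mul_inv_cancel (tsub_pos_of_lt hr1).ne' (ENNReal.sub_ne_top ENNReal.one_ne_top)
    nth_rewrite 1 [← h1]
    rw [← add_mul, tsub_add_cancel_of_le hr1.le, one_mul]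
  refine ⟨fun p => r ^ (n₀ - (p.1 + p.2)) * (x ^ p.1 * y ^ p.2) * (1 - r)⁻¹, fun s f => ?_, by simp⟩
  have key : ENNReal.ofReal a * (x ^ (s + 1) * y ^ f) + ENNReal.ofReal (1 - a) * (x ^ s * y ^ (f + 1))
      ≤ r * (x ^ s * y ^ f) := by
    refine le_trans (le_of_eq ?_) (mul_le_mul_left hr (x ^ s * y ^ f))
    ring
  by_cases h : n₀ ≤ s + f
  · have e1 : n₀ - (s + f) = 0 := by omega
    have e2 : n₀ - (s + 1 + f) = 0 := by omega
    have e3 : n₀ - (s + (f + 1)) = 0 := by omega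
    simp only [Set.indicator, Set.mem_ofPred_eq, h, if_true, e1, e2, e3, pow_zero, one_mul]
    calc _ = x ^ s * y ^ f + (ENNReal.ofReal a * (x ^ (s + 1) * y ^ f)
          + ENNReal.ofReal (1 - a) * (x ^ s * y ^ (f + 1))) * (1 - r)⁻¹ := by ring
      _ ≤ x ^ s * y ^ f + (r * (x ^ s * y ^ f)) * (1 - r)⁻¹ := by gcongr
      _ = x ^ s * y ^ f * (1 + r * (1 - r)⁻¹) := by ring
      _ = _ := by rw [hc]
  · obtain ⟨k, hk⟩ : ∃ k, n₀ - (s + f) = k + 1 := ⟨n₀ - (s + f) - 1, by omega⟩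
    have e2 : n₀ - (s + 1 + f) = k := by omega
    have e3 : n₀ - (s + (f + 1)) = k := by omega
    simp only [Set.indicator, Set.mem_ofPred_eq, h, if_false, hk, e2, e3, zero_add]
    calc _ = r ^ k * (ENNReal.ofReal a * (x ^ (s + 1) * y ^ f)
          + ENNReal.ofReal (1 - a) * (x ^ s * y ^ (f + 1))) * (1 - r)⁻¹ := by ring
      _ ≤ r ^ k * (r * (x ^ s * y ^ f)) * (1 - r)⁻¹ := by gcongr
      _ = _ := by ring

lemma exists_exp_moment_lt_one {a A B : ℝ} (ha : a ∈ Set.Icc (0 : ℝ) 1)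
    (hμ : 0 < a * A + (1 - a) * B) :
    ∃ l > 0, a * Real.exp (-(l * A)) + (1 - a) * Real.exp (-(l * B)) < 1 := by
  obtain ⟨h0, h1⟩ := ha
  set μ := a * A + (1 - a) * B with hμd
  set M := |A| + |B| + 1 with hM
  have hA : |A| ≤ M := by have := abs_nonneg B; linarith
  have hB : |B| ≤ M := by have := abs_nonneg A; linarith
  have hM1 : 1 ≤ M := by have := abs_nonneg A; have := abs_nonneg B; linarith
  have hμM : μ ≤ M := by
    have := le_abs_self A; have := le_abs_self B
    nlinarith
  -- This choice gives `|l * X| ≤ 1` for both increments and makes the quadratic remainder `l ^ 2 *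
  -- M ^ 2` half of the linear gain `l * μ`.
  set l := μ / (2 * M ^ 2) with hl
  have hlpos : 0 < l := by positivity
  have hlM : l * M ≤ 1 := by
    rw [hl, div_mul_eq_mul_div, div_le_one (by positivity)]
    nlinarith
  have hlM2 : l * M ^ 2 = μ / 2 := by
    rw [hl]; field_simp
  have bd : ∀ X : ℝ, |X| ≤ M → Real.exp (-(l * X)) ≤ 1 - l * X + l * (μ / 2) := by
    intro X hX
    have hx : |-(l * X)| ≤ 1 := by
      rw [abs_neg, abs_mul, abs_of_pos hlpos]
      nlinarith
    have := (abs_le.1 (Real.abs_exp_sub_one_sub_id_le hx)).2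
    have h2 : X ^ 2 ≤ M ^ 2 := by
      rw [← sq_abs X]; gcongr
    have h3 : (-(l * X)) ^ 2 ≤ l * (μ / 2) := by
      rw [← hlM2]
      have : l * l * X ^ 2 ≤ l * l * M ^ 2 := by gcongr
      nlinarith
    linarith
  refine ⟨l, hlpos, ?_⟩
  have b1 := mul_le_mul_of_nonneg_left (bd A hA) h0
  have b2 := mul_le_mul_of_nonneg_left (bd B hB) (sub_nonneg.2 h1)
  have : a * (1 - l * A + l * (μ / 2)) + (1 - a) * (1 - l * B + l * (μ / 2))
      = 1 - l * (μ / 2) := by rw [hμd]; ring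
  have : 0 < l * (μ / 2) := by positivity
  linarith

/-- Chernoff's bound: on the half-space the indicator is at most `exp (l * D)` times the product
weight `exp (-l * (A * s + B * f))`, to which `occBound_geometric` applies. -/
lemma occBound_halfspace_of_exp_moment_le {a A B l κ : ℝ} (ha : a ∈ Set.Icc (0 : ℝ) 1) (hl : 0 ≤ l)
    (hκ : 0 < κ) (h : a * Real.exp (-(l * A)) + (1 - a) * Real.exp (-(l * B)) ≤ Real.exp (-κ))
    (D : ℝ) (n₀ : ℕ) :
    OccBound a ({p : ℕ × ℕ | n₀ ≤ p.1 + p.2 ∧ A * p.1 + B * p.2 ≤ D}.indicator 1)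
      (ENNReal.ofReal (Real.exp (l * D) * (Real.exp (-(κ * n₀)) / (1 - Real.exp (-κ))))) := by
  have hlt : Real.exp (-κ) < 1 := by rw [← Real.exp_zero]; exact Real.exp_lt_exp.2 (by linarith)
  have hr : ENNReal.ofReal a * ENNReal.ofReal (Real.exp (-(l * A)))
      + ENNReal.ofReal (1 - a) * ENNReal.ofReal (Real.exp (-(l * B)))
      ≤ ENNReal.ofReal (Real.exp (-κ)) := by
    rw [← ENNReal.ofReal_mul ha.1, ← ENNReal.ofReal_mul (sub_nonneg.2 ha.2),
      ← ENNReal.ofReal_add (mul_nonneg ha.1 (Real.exp_nonneg _))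
        (mul_nonneg (sub_nonneg.2 ha.2) (Real.exp_nonneg _))]
    exact ENNReal.ofReal_le_ofReal h
  obtain ⟨φ, h1, h2⟩ := occBound_geometric hr (by simpa using hlt) n₀
  refine ⟨fun p => ENNReal.ofReal (Real.exp (l * D)) * φ p, fun s f => ?_, ?_⟩
  · refine le_trans ?_ (mul_le_mul_right (h1 s f) (ENNReal.ofReal (Real.exp (l * D))))
    rw [mul_add]
    refine add_le_add ?_ (le_of_eq (by ring))
    by_cases hp : n₀ ≤ s + f ∧ A * s + B * f ≤ D
    · simp only [Set.indicator, Set.mem_ofPred_eq, hp, and_self, if_true, Pi.one_apply]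
      rw [← ENNReal.ofReal_pow (Real.exp_nonneg _), ← ENNReal.ofReal_pow (Real.exp_nonneg _),
        ← ENNReal.ofReal_mul (by positivity), ← ENNReal.ofReal_mul (by positivity),
        ENNReal.one_le_ofReal, ← Real.exp_nat_mul, ← Real.exp_nat_mul, ← Real.exp_add,
        ← Real.exp_add, Real.one_le_exp_iff]
      nlinarith [hp.2]
    · simp [Set.indicator, hp]
  · refine (mul_le_mul_right h2 _).trans (le_of_eq ?_)
    rw [← ENNReal.ofReal_pow (Real.exp_nonneg _), ← ENNReal.ofReal_one,
      ← ENNReal.ofReal_sub _ (Real.exp_nonneg _), ← ENNReal.ofReal_inv_of_pos (by linarith),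
      ← ENNReal.ofReal_mul (by positivity), ← ENNReal.ofReal_mul (by positivity),
      ← Real.exp_nat_mul]
    congr 3
    ring_nf

lemma occBound_halfspace {a A B : ℝ} (ha : a ∈ Set.Icc (0 : ℝ) 1)
    (hμ : 0 < a * A + (1 - a) * B) :
    ∃ l > 0, ∃ κ > 0, ∀ (D : ℝ) (n₀ : ℕ),
      OccBound a ({p : ℕ × ℕ | n₀ ≤ p.1 + p.2 ∧ A * p.1 + B * p.2 ≤ D}.indicator 1)
        (ENNReal.ofReal (Real.exp (l * D) * (Real.exp (-(κ * n₀)) / (1 - Real.exp (-κ))))) := by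
  obtain ⟨l, hl, hlt⟩ := exists_exp_moment_lt_one ha hμ
  set r := a * Real.exp (-(l * A)) + (1 - a) * Real.exp (-(l * B)) with hr
  have hpos : 0 < r := by
    rcases ha.1.eq_or_lt with h | h
    · rw [hr, ← h]; simp [Real.exp_pos]
    · have : 0 ≤ (1 - a) * Real.exp (-(l * B)) :=
        mul_nonneg (sub_nonneg.2 ha.2) (Real.exp_nonneg _)
      have : 0 < a * Real.exp (-(l * A)) := mul_pos h (Real.exp_pos _)
      linarith
  refine ⟨l, hl, -Real.log r, neg_pos.2 (Real.log_neg hpos hlt), fun D n₀ => ?_⟩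
  refine occBound_halfspace_of_exp_moment_le ha hl.le (neg_pos.2 (Real.log_neg hpos hlt)) ?_ D n₀
  rw [neg_neg, Real.exp_log hpos]

/-- The expected number of visits of a Bernoulli walk with positive drift `μ` to `(-∞, L]` is at
most `L / μ` up to an additive constant. -/
lemma occBound_renewal {a A B : ℝ} (ha : a ∈ Set.Icc (0 : ℝ) 1)
    (hμ : 0 < a * A + (1 - a) * B) :
    ∃ C ≥ 0, ∀ L ≥ 0, OccBound a ({p : ℕ × ℕ | A * p.1 + B * p.2 ≤ L}.indicator 1)
        (ENNReal.ofReal (L / (a * A + (1 - a) * B) + C)) := by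
  obtain ⟨l, hl, hlt⟩ := exists_exp_moment_lt_one ha hμ
  obtain ⟨h0, h1⟩ := ha
  set μ := a * A + (1 - a) * B with hμd
  set ρ := a * Real.exp (-(l * A)) + (1 - a) * Real.exp (-(l * B)) with hρ
  set M := |A| + |B| with hM
  have hA := abs_le.1 (show |A| ≤ M by have := abs_nonneg B; linarith)
  have hB := abs_le.1 (show |B| ≤ M by have := abs_nonneg A; linarith)
  have hM0 : 0 ≤ M := by positivity
  set κ := M / μ / ((1 - ρ) * Real.exp (-(l * (2 * M)))) with hκ
  have hρ1 : 0 < 1 - ρ := by linarith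
  have hκ0 : 0 ≤ κ := by positivity
  -- The first summand loses exactly 1 per step on `x ≤ 0`, but its kink at `M` can raise it by up
  -- to `M / μ` on `0 < x ≤ 2 * M`. There the exponential supermartingale drops by at least the
  -- fraction `1 - ρ`, and `κ` is the factor for which this drop pays. Beyond `2 * M` a step cannot
  -- reach the kink.
  set h : ℝ → ℝ := fun x => max (M - x) 0 / μ + κ * min 1 (Real.exp (-(l * x))) with hh
  have hnn : ∀ x, 0 ≤ h x := fun x => by positivity
  have drift0 : ∀ x, x ≤ 0 → 1 + (a * h (x + A) + (1 - a) * h (x + B)) ≤ h x := by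
    intro x hx
    have e1 : max (M - (x + A)) 0 = M - (x + A) := max_eq_left (by linarith)
    have e2 : max (M - (x + B)) 0 = M - (x + B) := max_eq_left (by linarith)
    have e3 : max (M - x) 0 = M - x := max_eq_left (by linarith)
    have e4 : min 1 (Real.exp (-(l * x))) = 1 :=
      min_eq_left (Real.one_le_exp_iff.2 (by nlinarith))
    simp only [hh, e1, e2, e3, e4]
    have b1 := mul_le_mul_of_nonneg_left (min_le_left 1 (Real.exp (-(l * (x + A))))) (mul_nonneg h0 hκ0)
    have b2 := mul_le_mul_of_nonneg_left (min_le_left 1 (Real.exp (-(l * (x + B)))))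
      (mul_nonneg (sub_nonneg.2 h1) hκ0)
    have e5 : a * ((M - (x + A)) / μ) + (1 - a) * ((M - (x + B)) / μ) = (M - x) / μ - 1 := by
      field_simp
      rw [hμd]; ring
    nlinarith
  have drift1 : ∀ x, 0 < x → a * h (x + A) + (1 - a) * h (x + B) ≤ h x := by
    intro x hx
    have e4 : min 1 (Real.exp (-(l * x))) = Real.exp (-(l * x)) :=
      min_eq_right (Real.exp_le_one_iff.2 (by nlinarith))
    have m1 := min_le_right 1 (Real.exp (-(l * (x + A))))
    have m2 := min_le_right 1 (Real.exp (-(l * (x + B))))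
    have x1 : Real.exp (-(l * (x + A))) = Real.exp (-(l * x)) * Real.exp (-(l * A)) := by
      rw [← Real.exp_add]; ring_nf
    have x2 : Real.exp (-(l * (x + B))) = Real.exp (-(l * x)) * Real.exp (-(l * B)) := by
      rw [← Real.exp_add]; ring_nf
    have b1 := mul_le_mul_of_nonneg_left m1 (mul_nonneg h0 hκ0)
    have b2 := mul_le_mul_of_nonneg_left m2 (mul_nonneg (sub_nonneg.2 h1) hκ0)
    have c1 : a * κ * Real.exp (-(l * (x + A))) + (1 - a) * κ * Real.exp (-(l * (x + B)))
        = κ * (ρ * Real.exp (-(l * x))) := by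
      rw [x1, x2, hρ]; ring
    have c2 : a * (max (M - (x + A)) 0 / μ) + (1 - a) * (max (M - (x + B)) 0 / μ)
        ≤ max (M - x) 0 / μ + κ * ((1 - ρ) * Real.exp (-(l * x))) := by
      rcases le_or_gt x (2 * M) with hx2 | hx2
      · have d1 : max (M - (x + A)) 0 ≤ max (M - x) 0 + M :=
          max_le (by linarith [le_max_left (M - x) 0]) (by positivity)
        have d2 : max (M - (x + B)) 0 ≤ max (M - x) 0 + M :=
          max_le (by linarith [le_max_left (M - x) 0]) (by positivity)
        have d3 : M / μ ≤ κ * ((1 - ρ) * Real.exp (-(l * x))) := by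
          have : M / μ = κ * ((1 - ρ) * Real.exp (-(l * (2 * M)))) := by
            rw [hκ]; field_simp
          rw [this]
          gcongr
        have d4 : a * (max (M - (x + A)) 0 / μ) ≤ a * ((max (M - x) 0 + M) / μ) := by gcongr
        have d5 : (1 - a) * (max (M - (x + B)) 0 / μ) ≤ (1 - a) * ((max (M - x) 0 + M) / μ) := by
          have := sub_nonneg.2 h1
          gcongr
        have d6 : (max (M - x) 0 + M) / μ = max (M - x) 0 / μ + M / μ := add_div _ _ _
        nlinarith
      · have e1 : max (M - (x + A)) 0 = 0 := max_eq_right (by linarith)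
        have e2 : max (M - (x + B)) 0 = 0 := max_eq_right (by linarith)
        rw [e1, e2]
        simp only [zero_div, mul_zero, add_zero]
        positivity
    simp only [hh, e4]
    nlinarith
  refine ⟨M / μ + κ, by positivity, fun L hL => ⟨fun p => ENNReal.ofReal (h (A * p.1 + B * p.2 - L)),
    fun s f => ?_, ?_⟩⟩
  · rw [← ENNReal.ofReal_mul h0, ← ENNReal.ofReal_mul (sub_nonneg.2 h1),
      ← ENNReal.ofReal_add (mul_nonneg h0 (hnn _)) (mul_nonneg (sub_nonneg.2 h1) (hnn _))]
    have e1 : A * ((s + 1 : ℕ) : ℝ) + B * f - L = (A * s + B * f - L) + A := by push_cast; ring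
    have e2 : A * (s : ℝ) + B * ((f + 1 : ℕ) : ℝ) - L = (A * s + B * f - L) + B := by
      push_cast; ring
    simp only [e1, e2]
    by_cases hp : A * s + B * f ≤ L
    · simp only [Set.indicator, Set.mem_ofPred_eq, hp, if_true, Pi.one_apply]
      rw [← ENNReal.ofReal_one, ← ENNReal.ofReal_add zero_le_one (add_nonneg
        (mul_nonneg h0 (hnn _)) (mul_nonneg (sub_nonneg.2 h1) (hnn _)))]
      exact ENNReal.ofReal_le_ofReal (drift0 _ (by linarith))
    · simp only [Set.indicator, Set.mem_ofPred_eq, hp, if_false, zero_add]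
      exact ENNReal.ofReal_le_ofReal (drift1 _ (by linarith))
  · refine ENNReal.ofReal_le_ofReal ?_
    simp only [hh, Nat.cast_zero, mul_zero, add_zero, zero_sub, sub_neg_eq_add]
    rw [max_eq_left (by linarith)]
    have := mul_le_mul_of_nonneg_left (min_le_left 1 (Real.exp (-(l * -L)))) hκ0
    have e : (M + L) / μ = M / μ + L / μ := add_div _ _ _
    linarith

/-- A state with success frequency `p` is visited with probability at most `exp (-n kl(p ‖ a))`. -/
lemma occBound_singleton {a : ℝ} (h0 : 0 < a) (h1 : a < 1) (s₀ f₀ : ℕ) :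
    OccBound a (({(s₀, f₀)} : Set (ℕ × ℕ)).indicator 1)
      (ENNReal.ofReal (((s₀ / (s₀ + f₀ : ℝ) / a) ^ s₀ * (f₀ / (s₀ + f₀ : ℝ) / (1 - a)) ^ f₀)⁻¹)) := by
  set x : ℝ := s₀ / (s₀ + f₀ : ℝ) / a with hx
  set y : ℝ := f₀ / (s₀ + f₀ : ℝ) / (1 - a) with hy
  have h1' : 0 < 1 - a := by linarith
  have hx0 : 0 ≤ x := by positivity
  have hy0 : 0 ≤ y := by positivity
  have hxy : a * x + (1 - a) * y ≤ 1 := by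
    have : a * x + (1 - a) * y = (s₀ + f₀ : ℝ) / (s₀ + f₀) := by
      rw [hx, hy]; field_simp
    rw [this]
    -- Only an inequality, since the quotient is `0 / 0 = 0` when `s₀ + f₀ = 0`.
    exact div_self_le_one _
  have hpos : 0 < x ^ s₀ * y ^ f₀ := by
    refine mul_pos ?_ ?_
    · rcases Nat.eq_zero_or_pos s₀ with h | h
      · simp [h]
      · have : (0 : ℝ) < s₀ := by exact_mod_cast h
        positivity
    · rcases Nat.eq_zero_or_pos f₀ with h | h
      · simp [h]
      · have : (0 : ℝ) < f₀ := by exact_mod_cast h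
        positivity
  -- The likelihood ratio of the Bernoulli law with the target frequency against Bernoulli(`a`),
  -- scaled to 1 at the target and cut off once the target can no longer be reached.
  refine ⟨{p | p.1 + p.2 ≤ s₀ + f₀}.indicator
    fun p => ENNReal.ofReal (x ^ p.1 * y ^ p.2 * (x ^ s₀ * y ^ f₀)⁻¹), fun s f => ?_, by simp⟩
  by_cases h : s + f < s₀ + f₀
  · have e1 : s + 1 + f ≤ s₀ + f₀ := by omega
    have e2 : s + (f + 1) ≤ s₀ + f₀ := by omega
    have e3 : ¬ (s = s₀ ∧ f = f₀) := by omega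
    simp only [Set.indicator, Set.mem_ofPred_eq, e1, e2, h.le, if_true, Set.mem_singleton_iff,
      Prod.mk.injEq, e3, if_false, zero_add]
    rw [← ENNReal.ofReal_mul h0.le, ← ENNReal.ofReal_mul h1'.le,
      ← ENNReal.ofReal_add (by positivity) (by positivity)]
    refine ENNReal.ofReal_le_ofReal ?_
    have := mul_le_mul_of_nonneg_left hxy
      (show 0 ≤ x ^ s * y ^ f * (x ^ s₀ * y ^ f₀)⁻¹ by positivity)
    calc _ = x ^ s * y ^ f * (x ^ s₀ * y ^ f₀)⁻¹ * (a * x + (1 - a) * y) := by ring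
      _ ≤ _ := by rw [mul_one] at this; exact this
  · have e1 : ¬ s + 1 + f ≤ s₀ + f₀ := by omega
    have e2 : ¬ s + (f + 1) ≤ s₀ + f₀ := by omega
    simp only [Set.indicator, Set.mem_ofPred_eq, e1, e2, if_false, mul_zero, add_zero]
    by_cases hp : (s, f) = (s₀, f₀)
    · obtain ⟨rfl, rfl⟩ := Prod.mk.inj hp
      simp only [Set.mem_singleton_iff, if_true, Pi.one_apply, le_refl,
        mul_inv_cancel₀ hpos.ne', ENNReal.ofReal_one]
    · simp [hp]

/-- An impossible event is not visited. -/
lemma occBound_success_of_eq_zero {a : ℝ} :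
    OccBound a ({p : ℕ × ℕ | a = 0 ∧ 1 ≤ p.1}.indicator 1) 0 := by
  -- The infinite value is harmless: it is entered only by a success, which has weight 0, and `0 * ⊤
  -- = 0`.
  refine ⟨{p : ℕ × ℕ | a = 0 ∧ 1 ≤ p.1}.indicator ⊤, fun s f => ?_, by simp⟩
  by_cases h : a = 0
  · subst h
    rcases Nat.eq_zero_or_pos s with hs | hs
    · subst hs
      simp
    · have : 1 ≤ s := hs
      simp [Set.indicator, this]
  · simp [h]

/-! ### Counts along a run and expected occupation -/

section Counts

variable {N : ℕ}

/-- The number of observed failures of item `i` in rounds `1, …, t`. -/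
def failures (A : ℕ → Finset (Fin N)) (z : ℕ → Fin N → Bool) (i : Fin N) (t : ℕ) : ℕ :=
  {s ∈ Finset.Icc 1 t | i ∈ A s ∧ z s i = false}.card

/-- The pair of success and failure counts of item `i` after round `t`. -/
def counts (A : ℕ → Finset (Fin N)) (z : ℕ → Fin N → Bool) (i : Fin N) (t : ℕ) : ℕ × ℕ :=
  (successes A z i t, failures A z i t)

lemma card_filter_Icc_succ (P : ℕ → Prop) [DecidablePred P] (t : ℕ) :
    {s ∈ Finset.Icc 1 (t + 1) | P s}.card
      = {s ∈ Finset.Icc 1 t | P s}.card + if P (t + 1) then 1 else 0 := by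
  rw [← Finset.insert_Icc_right_eq_Icc_add_one (by omega), Finset.filter_insert]
  split_ifs with h
  · rw [Finset.card_insert_of_notMem (by simp)]
  · simp

lemma pulls_succ (A : ℕ → Finset (Fin N)) (i : Fin N) (t : ℕ) :
    pulls A i (t + 1) = pulls A i t + if i ∈ A (t + 1) then 1 else 0 :=
  card_filter_Icc_succ _ t

lemma counts_succ (A : ℕ → Finset (Fin N)) (z : ℕ → Fin N → Bool) (i : Fin N) (t : ℕ) :
    counts A z i (t + 1) = if i ∈ A (t + 1) then
      (if z (t + 1) i = true then ((counts A z i t).1 + 1, (counts A z i t).2)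
        else ((counts A z i t).1, (counts A z i t).2 + 1)) else counts A z i t := by
  have h1 := card_filter_Icc_succ (fun s => i ∈ A s ∧ z s i = true) t
  have h2 := card_filter_Icc_succ (fun s => i ∈ A s ∧ z s i = false) t
  unfold counts successes failures
  rw [h1, h2]
  by_cases hi : i ∈ A (t + 1) <;> by_cases hz : z (t + 1) i = true <;> simp [hi, hz]

lemma counts_zero (A : ℕ → Finset (Fin N)) (z : ℕ → Fin N → Bool) (i : Fin N) :
    counts A z i 0 = (0, 0) := by
  simp [counts, successes, failures]

lemma counts_add (A : ℕ → Finset (Fin N)) (z : ℕ → Fin N → Bool) (i : Fin N) (t : ℕ) :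
    (counts A z i t).1 + (counts A z i t).2 = pulls A i t := by
  induction t with
  | zero => simp [counts_zero, pulls]
  | succ t ih =>
    rw [counts_succ, pulls_succ, ← ih]
    split_ifs <;> simp <;> omega

/-- The total of `ψ` over the states that the counts of item `i` visit up to round `T`. -/
noncomputable def occ (A : ℕ → Finset (Fin N)) (z : ℕ → Fin N → Bool) (i : Fin N)
    (ψ : ℕ × ℕ → ℝ≥0∞) (T : ℕ) : ℝ≥0∞ :=
  ∑ r ∈ Finset.Icc 1 T, (if i ∈ A r then ψ (counts A z i (r - 1)) else 0) + ψ (counts A z i T)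

lemma occ_succ (A : ℕ → Finset (Fin N)) (z : ℕ → Fin N → Bool) (i : Fin N)
    (ψ : ℕ × ℕ → ℝ≥0∞) (T : ℕ) :
    occ A z i ψ (T + 1) = occ A z i ψ T
      + if i ∈ A (T + 1) then ψ (counts A z i (T + 1)) else 0 := by
  unfold occ
  rw [Finset.sum_Icc_succ_top (by omega)]
  by_cases hi : i ∈ A (T + 1)
  · simp only [hi, if_true, add_tsub_cancel_right]
  · rw [counts_succ]
    simp [hi]

/-- A state counts once in `occ`, however long the item stays unselected. Asking for a visit at any
time up to `T` therefore costs no union bound over rounds. -/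
lemma le_occ (A : ℕ → Finset (Fin N)) (z : ℕ → Fin N → Bool) (i : Fin N)
    (ψ : ℕ × ℕ → ℝ≥0∞) {t T : ℕ} (h : t ≤ T) : ψ (counts A z i t) ≤ occ A z i ψ T := by
  have hm : Monotone (occ A z i ψ) := monotone_nat_of_le_succ fun n => by
    rw [occ_succ]; exact le_self_add
  exact le_trans le_add_self (hm h)

lemma sum_pulls_le_occ (A : ℕ → Finset (Fin N)) (z : ℕ → Fin N → Bool) (i : Fin N)
    (ψ : ℕ × ℕ → ℝ≥0∞) (T : ℕ) :
    ∑ r ∈ Finset.Icc 1 T, (if i ∈ A r then ψ (counts A z i (r - 1)) else 0) ≤ occ A z i ψ T :=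
  le_self_add

end Counts

/-- One supermartingale step with optional skipping. On the selection event `B` the integrand is
split by the value of `Z`; independence factors each integral, and superharmonicity applies
pointwise to the result. -/
lemma lintegral_step_le {Ω : Type*} {m : MeasurableSpace Ω} [mΩ : MeasurableSpace Ω] {μ : Measure Ω}
    [IsProbabilityMeasure μ] (hm : m ≤ mΩ) {a : ℝ}
    (ha : a ∈ Set.Icc (0 : ℝ) 1) {X : Ω → ℕ × ℕ} (hX : Measurable[m] X) {B : Set Ω}
    (hB : MeasurableSet[m] B) {Z : Ω → Bool} (hZ : Measurable Z)
    (hind : Indep (MeasurableSpace.comap Z inferInstance) m μ)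
    (hZa : μ {ω | Z ω = true} = ENNReal.ofReal a) {ψ φ : ℕ × ℕ → ℝ≥0∞}
    (hφ : ∀ s f, ψ (s, f) + (ENNReal.ofReal a * φ (s + 1, f)
      + ENNReal.ofReal (1 - a) * φ (s, f + 1)) ≤ φ (s, f)) [DecidablePred (· ∈ B)] :
    ∫⁻ ω, ((if ω ∈ B then ψ (X ω) else 0) + φ (if ω ∈ B then
      (if Z ω = true then ((X ω).1 + 1, (X ω).2) else ((X ω).1, (X ω).2 + 1)) else X ω)) ∂μ
      ≤ ∫⁻ ω, φ (X ω) ∂μ := by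
  have hZb : μ {ω | Z ω = false} = ENNReal.ofReal (1 - a) := by
    have : {ω | Z ω = false} = {ω | Z ω = true}ᶜ := by ext; simp
    rw [this, prob_compl_eq_one_sub (s := {ω | Z ω = true}) (hZ (measurableSet_singleton true)), hZa,
      ENNReal.ofReal_sub _ ha.1, ENNReal.ofReal_one]
  have hmeas : ∀ g : ℕ × ℕ → ℝ≥0∞, Measurable[m] (fun ω => B.indicator (fun ω => g (X ω)) ω) :=
    fun g => ((Measurable.of_discrete (f := g)).comp hX).indicator hB
  set F₁ : Ω → ℝ≥0∞ := B.indicator fun ω => φ ((X ω).1 + 1, (X ω).2) with hF₁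
  set F₂ : Ω → ℝ≥0∞ := B.indicator fun ω => φ ((X ω).1, (X ω).2 + 1) with hF₂
  set F₀ : Ω → ℝ≥0∞ := fun ω => B.indicator (fun ω => ψ (X ω)) ω
    + Bᶜ.indicator (fun ω => φ (X ω)) ω with hF₀
  have m₁ : Measurable[m] F₁ := hmeas fun p => φ (p.1 + 1, p.2)
  have m₂ : Measurable[m] F₂ := hmeas fun p => φ (p.1, p.2 + 1)
  have m₀ : Measurable[m] F₀ :=
    (hmeas ψ).add (((Measurable.of_discrete (f := φ)).comp hX).indicator hB.compl)
  have prodInt : ∀ (F : Ω → ℝ≥0∞) (b : Bool), Measurable[m] F →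
      ∫⁻ ω, {ω | Z ω = b}.indicator 1 ω * F ω ∂μ = μ {ω | Z ω = b} * ∫⁻ ω, F ω ∂μ := by
    intro F b hF
    have hs : MeasurableSet[MeasurableSpace.comap Z inferInstance] {ω | Z ω = b} :=
      ⟨{b}, measurableSet_singleton b, rfl⟩
    have := lintegral_mul_eq_lintegral_mul_lintegral_of_independent_measurableSpace (μ := μ)
      hZ.comap_le hm hind
      (f := {ω | Z ω = b}.indicator 1) (g := F) (Measurable.indicator
        (@measurable_const _ _ _ (MeasurableSpace.comap Z inferInstance) (1 : ℝ≥0∞)) hs) hF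
    rw [lintegral_indicator_one (hZ.comap_le _ hs)] at this
    exact this
  have split : ∀ ω, ((if ω ∈ B then ψ (X ω) else 0) + φ (if ω ∈ B then
      (if Z ω = true then ((X ω).1 + 1, (X ω).2) else ((X ω).1, (X ω).2 + 1)) else X ω))
      = F₀ ω + ({ω | Z ω = true}.indicator 1 ω * F₁ ω + {ω | Z ω = false}.indicator 1 ω * F₂ ω) := by
    intro ω
    by_cases hb : ω ∈ B <;> cases hz : Z ω <;> simp [hF₀, hF₁, hF₂, hb, hz]
  have mi : ∀ b : Bool, Measurable ({ω | Z ω = b}.indicator (1 : Ω → ℝ≥0∞)) :=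
    fun b => measurable_one.indicator (hZ (measurableSet_singleton b))
  have mi₁ : Measurable fun ω => {ω | Z ω = true}.indicator (1 : Ω → ℝ≥0∞) ω * F₁ ω :=
    (mi true).mul (m₁.mono hm le_rfl)
  simp_rw [split]
  rw [lintegral_add_left (m₀.mono hm le_rfl),
    lintegral_add_left mi₁, prodInt _ _ m₁, prodInt _ _ m₂, hZa, hZb,
    ← lintegral_const_mul _ (m₁.mono hm le_rfl), ← lintegral_const_mul _ (m₂.mono hm le_rfl),
    ← lintegral_add_left ((m₁.mono hm le_rfl).const_mul _),
    ← lintegral_add_left (m₀.mono hm le_rfl)]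
  refine lintegral_mono fun ω => ?_
  by_cases hb : ω ∈ B
  · simpa [hF₀, hF₁, hF₂, hb] using hφ (X ω).1 (X ω).2
  · simp [hF₀, hF₁, hF₂, hb]

section Run

variable {N K : ℕ} {Ω : Type*} [mΩ : MeasurableSpace Ω] {μ : Measure Ω}
  {ℱ : Filtration ℕ mΩ} {G : Matrix (Fin N) (Fin N) ℝ} {ε c : ℝ} {α : Fin N → ℝ} {T : ℕ}
  {z : ℕ → Fin N → Ω → Bool} {A : ℕ → Ω → Finset (Fin N)}

lemma IsRun.measurableSet_mem (h : IsRun μ ℱ G K ε c α T z A) {t : ℕ} (ht : t ∈ Finset.Icc 1 T)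
    (i : Fin N) : MeasurableSet[ℱ (t - 1)] {ω | i ∈ A t ω} := by
  have : {ω | i ∈ A t ω} = ⋃ S ∈ {S : Finset (Fin N) | i ∈ S}, {ω | A t ω = S} := by
    ext; simp
  rw [this]
  exact MeasurableSet.biUnion (Set.to_countable _) fun S _ => h.predictable t ht S

lemma IsRun.measurable_counts (h : IsRun μ ℱ G K ε c α T z A) (i : Fin N) {t : ℕ} (ht : t ≤ T) :
    Measurable[ℱ t] fun ω => counts (fun s => A s ω) (fun s i => z s i ω) i t := by
  classical
  induction t with
  | zero =>
    simp only [counts_zero]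
    exact measurable_const
  | succ t ih =>
    have hX := (ih (by omega)).mono (ℱ.mono (Nat.le_succ t)) le_rfl
    have ht' : t + 1 ∈ Finset.Icc 1 T := by simp; omega
    have hB : MeasurableSet[ℱ (t + 1)] {ω | i ∈ A (t + 1) ω} :=
      ℱ.mono (Nat.le_succ t) _ (h.measurableSet_mem ht' i)
    have hS := h.feedback _ ht' i
    have e : (fun ω => counts (fun s => A s ω) (fun s i => z s i ω) i (t + 1)) = fun ω =>
        if ω ∈ {ω | i ∈ A (t + 1) ω} then
          (if ω ∈ {ω | i ∈ A (t + 1) ω ∧ z (t + 1) i ω = true} then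
            ((counts (fun s => A s ω) (fun s i => z s i ω) i t).1 + 1,
              (counts (fun s => A s ω) (fun s i => z s i ω) i t).2)
          else ((counts (fun s => A s ω) (fun s i => z s i ω) i t).1,
            (counts (fun s => A s ω) (fun s i => z s i ω) i t).2 + 1))
        else counts (fun s => A s ω) (fun s i => z s i ω) i t := by
      ext1 ω
      rw [counts_succ]
      by_cases hi : i ∈ A (t + 1) ω <;> simp [hi]
    rw [e]
    refine Measurable.ite hB (Measurable.ite hS ?_ ?_) hX
    · exact (Measurable.of_discrete (f := fun p : ℕ × ℕ => (p.1 + 1, p.2))).comp hX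
    · exact (Measurable.of_discrete (f := fun p : ℕ × ℕ => (p.1, p.2 + 1))).comp hX

lemma IsRun.measurable_pull (h : IsRun μ ℱ G K ε c α T z A) (i : Fin N) (ψ : ℕ × ℕ → ℝ≥0∞)
    {t : ℕ} (ht : t ∈ Finset.Icc 1 T) :
    Measurable fun ω => if i ∈ A t ω then
      ψ (counts (fun s => A s ω) (fun s i => z s i ω) i (t - 1)) else 0 := by
  classical
  have ht' := Finset.mem_Icc.1 ht
  exact Measurable.ite (ℱ.le _ _ (h.measurableSet_mem ht i)) ((Measurable.of_discrete (f := ψ)).comp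
    ((h.measurable_counts i (by omega)).mono (ℱ.le _) le_rfl)) measurable_const

lemma IsRun.measurable_occ (h : IsRun μ ℱ G K ε c α T z A) (i : Fin N) (ψ : ℕ × ℕ → ℝ≥0∞) :
    Measurable fun ω => occ (fun s => A s ω) (fun s i => z s i ω) i ψ T :=
  (Finset.measurable_fun_sum _ fun _ ht => h.measurable_pull i ψ ht).add
    ((Measurable.of_discrete (f := ψ)).comp ((h.measurable_counts i le_rfl).mono (ℱ.le _) le_rfl))

/-- The charges so far plus `φ` of the current counts form a supermartingale started at `φ (0, 0)`.
The final state is charged by means of `ψ ≤ φ`. -/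
lemma IsRun.lintegral_occ_le [IsProbabilityMeasure μ] (h : IsRun μ ℱ G K ε c α T z A) {i : Fin N}
    (hα : α i ∈ Set.Icc (0 : ℝ) 1) {ψ : ℕ × ℕ → ℝ≥0∞} {b : ℝ≥0∞} (hψ : OccBound (α i) ψ b) :
    ∫⁻ ω, occ (fun s => A s ω) (fun s i => z s i ω) i ψ T ∂μ ≤ b := by
  classical
  obtain ⟨φ, hφ, hb⟩ := hψ
  have main : ∀ t ≤ T, ∫⁻ ω, (∑ r ∈ Finset.Icc 1 t, (if i ∈ A r ω then
      ψ (counts (fun s => A s ω) (fun s i => z s i ω) i (r - 1)) else 0)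
      + φ (counts (fun s => A s ω) (fun s i => z s i ω) i t)) ∂μ ≤ φ (0, 0) := by
    intro t ht
    induction t with
    | zero => simp [counts_zero]
    | succ t ih =>
      have ht' : t + 1 ∈ Finset.Icc 1 T := by simp; omega
      have hX := h.measurable_counts i (show t ≤ T by omega)
      have hS : Measurable fun ω => ∑ r ∈ Finset.Icc 1 t, (if i ∈ A r ω then
          ψ (counts (fun s => A s ω) (fun s i => z s i ω) i (r - 1)) else 0) :=
        Finset.measurable_fun_sum _ fun r hr => h.measurable_pull i ψ (by
          simp only [Finset.mem_Icc] at hr ⊢; omega)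
      have hind : Indep (MeasurableSpace.comap (z (t + 1) i) inferInstance) (ℱ t) μ := by
        refine indep_of_indep_of_le_left (h.indep_past _ ht') ?_
        have : z (t + 1) i = (fun g : Fin N → Bool => g i) ∘ fun ω j => z (t + 1) j ω := rfl
        rw [this, ← MeasurableSpace.comap_comp]
        exact MeasurableSpace.comap_mono (measurable_pi_apply i).comap_le
      have step := lintegral_step_le (ℱ.le t) hα hX (h.measurableSet_mem ht' i)
        (h.measurable_outcome _ ht' i) hind (h.bernoulli _ ht' i) hφ
      refine le_trans ?_ (ih (by omega))
      simp_rw [Finset.sum_Icc_succ_top (Nat.succ_le_succ (Nat.zero_le t)), add_assoc]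
      rw [lintegral_add_left hS, lintegral_add_left hS]
      refine add_le_add le_rfl (le_trans (le_of_eq ?_) step)
      refine lintegral_congr fun ω => ?_
      rw [counts_succ]
      simp
  refine le_trans (lintegral_mono fun ω => ?_) ((main T le_rfl).trans hb)
  exact add_le_add le_rfl (le_trans le_self_add (hφ _ _))

end Run

/-! ### Bernoulli relative entropy and the index -/

/-- The relative entropy of Bernoulli laws as a real number. -/
noncomputable def klReal (p v : ℝ) : ℝ :=
  p * Real.log (p / v) + (1 - p) * Real.log ((1 - p) / (1 - v))

lemma klBer_eq_ofReal {p v : ℝ} (h0 : v ≠ 0) (h1 : v ≠ 1) :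
    klBer p v = ENNReal.ofReal (klReal p v) := by
  simp [klBer, klReal, h0, h1]

lemma klBer_self (p : ℝ) : klBer p p = 0 := by
  have h1 : p * Real.log (p / p) = 0 := by
    by_cases h : p = 0
    · simp [h]
    · simp [h]
  have h2 : (1 - p) * Real.log ((1 - p) / (1 - p)) = 0 := by
    by_cases h : 1 - p = 0
    · simp [h]
    · simp [h]
  rw [klBer, h1, h2]
  simp

/-- This is `log y ≤ y - 1` at `y = a / x`. The last hypothesis excludes the junk value `log 0 = 0`
where the true logarithm is `-∞`. -/
lemma mul_log_div_le_add {x a v : ℝ} (hx : 0 ≤ x) (ha : 0 ≤ a) (hv : 0 < v) (h : a = 0 → x = 0) :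
    x * Real.log (a / v) ≤ x * Real.log (x / v) + (a - x) := by
  rcases hx.eq_or_lt with rfl | hx
  · simpa using ha
  · have ha : 0 < a := lt_of_le_of_ne ha fun h' => hx.ne' (h h'.symm)
    have h1 := Real.log_le_sub_one_of_pos (div_pos ha hx)
    rw [Real.log_div ha.ne' hx.ne'] at h1
    rw [Real.log_div ha.ne' hv.ne', Real.log_div hx.ne' hv.ne']
    have h2 := mul_le_mul_of_nonneg_left h1 hx.le
    have h3 : x * (a / x - 1) = a - x := by field_simp
    linarith

/-- Gibbs' inequality. -/
lemma mul_log_add_mul_log_le_klReal {p a v : ℝ} (hp : p ∈ Set.Icc (0 : ℝ) 1) (ha0 : 0 ≤ a)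
    (ha1 : a < 1) (hv0 : 0 < v) (hv1 : v < 1) (h : a = 0 → p = 0) :
    p * Real.log (a / v) + (1 - p) * Real.log ((1 - a) / (1 - v)) ≤ klReal p v := by
  have h1 := mul_log_div_le_add hp.1 ha0 hv0 h
  have h2 := mul_log_div_le_add (x := 1 - p) (a := 1 - a) (v := 1 - v) (by linarith [hp.2])
    (by linarith) (by linarith) (fun h => by linarith)
  unfold klReal
  linarith

lemma klReal_self (p : ℝ) : klReal p p = 0 := by
  unfold klReal
  by_cases h : p = 0
  · simp [h]
  · by_cases h' : 1 - p = 0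
    · simp [h, h']
    · simp [h, h']

lemma klReal_pos {p v : ℝ} (hp0 : 0 ≤ p) (hpv : p < v) (hv : v < 1) : 0 < klReal p v := by
  have hv0 : 0 < v := by linarith
  have h1 : p - v ≤ p * Real.log (p / v) := by
    have := mul_log_div_le_add (a := v) hp0 hv0.le hv0 (fun h => by linarith)
    rw [div_self hv0.ne', Real.log_one] at this
    linarith
  have h2 : v - p < (1 - p) * Real.log ((1 - p) / (1 - v)) := by
    have hx : 0 < (1 - v) / (1 - p) := div_pos (by linarith) (by linarith)
    have hne : (1 - v) / (1 - p) ≠ 1 := by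
      rw [Ne, div_eq_one_iff_eq (by linarith)]
      intro h; linarith
    have h3 := Real.log_lt_sub_one_of_pos hx hne
    have h4 : Real.log ((1 - p) / (1 - v)) = -Real.log ((1 - v) / (1 - p)) := by
      rw [← Real.log_inv, inv_div]
    have h5 := mul_lt_mul_of_pos_left h3 (show 0 < 1 - p by linarith)
    have h6 : (1 - p) * ((1 - v) / (1 - p) - 1) = p - v := by
      have : 1 - p ≠ 0 := by linarith
      field_simp
      ring
    rw [h4]
    linarith
  unfold klReal
  linarith

lemma klReal_mono_right {p v u : ℝ} (hp : 0 ≤ p) (hpv : p ≤ v) (hv : 0 < v) (hvu : v ≤ u)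
    (hu : u < 1) : klReal p v ≤ klReal p u := by
  have key : ∀ x y w : ℝ, 0 ≤ x → 0 < y → 0 < w →
      x * Real.log (x / y) ≤ x * Real.log (x / w) + x * (w / y - 1) := by
    intro x y w hx hy hw
    rcases hx.eq_or_lt with rfl | hx
    · simp
    · have h1 := Real.log_le_sub_one_of_pos (div_pos hw hy)
      rw [Real.log_div hw.ne' hy.ne'] at h1
      rw [Real.log_div hx.ne' hy.ne', Real.log_div hx.ne' hw.ne', ← mul_add]
      exact mul_le_mul_of_nonneg_left (by linarith) hx.le
  have h1 := key p v u hp hv (by linarith)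
  have h2 := key (1 - p) (1 - v) (1 - u) (by linarith) (by linarith) (by linarith)
  -- The first-order error terms of `log y ≤ y - 1` combine to an expression whose sign is that of
  -- `p - v`.
  have h3 : p * (u / v - 1) + (1 - p) * ((1 - u) / (1 - v) - 1)
      = (u - v) * (p - v) / (v * (1 - v)) := by
    have : 1 - v ≠ 0 := by linarith
    field_simp
    ring
  have h4 : (u - v) * (p - v) / (v * (1 - v)) ≤ 0 :=
    div_nonpos_of_nonpos_of_nonneg (mul_nonpos_of_nonneg_of_nonpos (by linarith) (by linarith))
      (mul_nonneg hv.le (by linarith))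
  unfold klReal
  linarith

/-- The log-likelihood ratio between the Bernoulli laws of parameters `a` and `v`, at a pair of
success and failure counts. -/
noncomputable def walk (a v : ℝ) (x : ℕ × ℕ) : ℝ :=
  Real.log (a / v) * x.1 + Real.log ((1 - a) / (1 - v)) * x.2

lemma walk_eq {a v : ℝ} {s f : ℕ} (hn : 1 ≤ s + f) :
    walk a v (s, f) = (s + f : ℝ) * (s / (s + f : ℝ) * Real.log (a / v)
      + (1 - s / (s + f : ℝ)) * Real.log ((1 - a) / (1 - v))) := by
  have : (0 : ℝ) < s + f := by exact_mod_cast hn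
  unfold walk
  field_simp
  ring

lemma frac_mem_Icc (s f : ℕ) : (s / (s + f : ℝ)) ∈ Set.Icc (0 : ℝ) 1 :=
  ⟨by positivity, div_le_one_of_le₀ (by linarith [Nat.cast_nonneg (α := ℝ) f]) (by positivity)⟩

/-- This turns the nonlinear index condition into a linear one on the counts. At frequency `p ≤ v`,
the walk is at most `n * kl(p ‖ v)` by Gibbs, and monotonicity passes from `v` to `u`. For `p > v`
the walk is not positive: per observation it is decreasing in `p`, and at `p = v` it is at most 0.
-/
lemma walk_le_of_klBer_le {a v u l : ℝ} {s f : ℕ} (hn : 1 ≤ s + f) (ha0 : 0 ≤ a) (hav : a < v)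
    (hv1 : v < 1) (hvu : v ≤ u) (hu2 : u ≤ 1) (hs : a = 0 → s = 0) (hl : 0 ≤ l)
    (hu : ((s + f : ℕ) : ℝ≥0∞) * klBer (s / (s + f : ℝ)) u ≤ ENNReal.ofReal l) :
    walk a v (s, f) ≤ l := by
  rw [walk_eq hn]
  have hp := frac_mem_Icc s f
  have hn' : (0 : ℝ) < s + f := by exact_mod_cast hn
  have hs' : a = 0 → (s / (s + f : ℝ)) = 0 := fun h => by simp [hs h]
  set p : ℝ := s / (s + f : ℝ) with hpd
  have hv0 : 0 < v := by linarith
  rcases le_or_gt p v with hpv | hpv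
  · have hu1 : u ≠ 1 := by
      rintro rfl
      have : klBer p 1 = ⊤ := by
        have : p ≠ 1 := by linarith
        simp [klBer, this]
      rw [this, ENNReal.mul_top (by exact_mod_cast (by omega : s + f ≠ 0))] at hu
      exact absurd hu (by simp)
    rw [klBer_eq_ofReal (by linarith) hu1, ← ENNReal.ofReal_natCast,
      ← ENNReal.ofReal_mul (by positivity), ENNReal.ofReal_le_ofReal_iff hl] at hu
    push_cast at hu
    have hG := mul_log_add_mul_log_le_klReal hp ha0 (by linarith) hv0 hv1 hs'
    have hM := klReal_mono_right hp.1 hpv hv0 hvu (lt_of_le_of_ne hu2 hu1)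
    calc _ ≤ (s + f : ℝ) * klReal p u := by gcongr; linarith
      _ ≤ l := hu
  · have ha : 0 < a := by
      refine lt_of_le_of_ne ha0 fun h => ?_
      rw [hs' h.symm] at hpv
      linarith
    have hG := mul_log_add_mul_log_le_klReal (p := v) ⟨hv0.le, hv1.le⟩ ha0 (by linarith) hv0 hv1
      (fun h => absurd h ha.ne')
    rw [klReal_self] at hG
    have h1 : Real.log (a / v) ≤ 0 := Real.log_nonpos (by positivity) (div_le_one_of_le₀ hav.le hv0.le)
    have h2 : 0 ≤ Real.log ((1 - a) / (1 - v)) :=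
      Real.log_nonneg ((one_le_div (by linarith)).2 (by linarith))
    have h3 : p * Real.log (a / v) + (1 - p) * Real.log ((1 - a) / (1 - v)) ≤ 0 := by nlinarith
    exact (mul_nonpos_of_nonneg_of_nonpos hn'.le h3).trans hl

lemma le_klUCB {c u p : ℝ} {t n : ℕ} (hu : u ∈ Set.Icc (0 : ℝ) 1)
    (h : (n : ℝ≥0∞) * klBer p u ≤ ENNReal.ofReal (level c t)) : u ≤ klUCB c t n p := by
  unfold klUCB
  split_ifs
  · exact hu.2
  · exact le_csSup ⟨1, fun w hw => hw.1.2⟩ ⟨hu, h⟩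

lemma self_le_klUCB {c p : ℝ} {t n : ℕ} (hp : p ∈ Set.Icc (0 : ℝ) 1) : p ≤ klUCB c t n p :=
  le_klUCB hp (by simp [klBer_self])

lemma exists_of_lt_klUCB {c w p : ℝ} {t n : ℕ} (hn : n ≠ 0) (hp : p ∈ Set.Icc (0 : ℝ) 1)
    (h : w < klUCB c t n p) : ∃ u, w < u ∧ u ∈ Set.Icc (0 : ℝ) 1 ∧
      (n : ℝ≥0∞) * klBer p u ≤ ENNReal.ofReal (level c t) := by
  rw [klUCB, if_neg hn] at h
  obtain ⟨u, hu, hwu⟩ := exists_lt_of_lt_csSup (by exact ⟨p, hp, by simp [klBer_self]⟩) h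
  exact ⟨u, hwu, hu⟩

lemma level_lt_of_klUCB_lt {c q : ℝ} {t s f : ℕ} (hq : q < 1)
    (h : klUCB c t (s + f) (s / (s + f : ℝ)) < q) :
    (s : ℝ) < (s + f) * q ∧ level c t < (s + f) * klReal (s / (s + f : ℝ)) q := by
  have hn : s + f ≠ 0 := by
    intro h0
    rw [h0, klUCB, if_pos rfl] at h
    linarith
  have hp := frac_mem_Icc s f
  have hpU := self_le_klUCB (c := c) (t := t) (n := s + f) hp
  have hn' : (0 : ℝ) < s + f := by exact_mod_cast Nat.pos_of_ne_zero hn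
  have hpq : (s / (s + f : ℝ)) < q := by linarith
  refine ⟨by rwa [div_lt_iff₀' hn'] at hpq, ?_⟩
  by_contra hcon
  have hq0 : 0 < q := lt_of_le_of_lt hp.1 hpq
  refine absurd (le_klUCB (c := c) (t := t) (n := s + f) (p := s / (s + f : ℝ))
    (show q ∈ Set.Icc (0 : ℝ) 1 from ⟨hq0.le, hq.le⟩) ?_) (not_le.2 h)
  rw [klBer_eq_ofReal hq0.ne' hq.ne, ← ENNReal.ofReal_natCast, ← ENNReal.ofReal_mul (by positivity)]
  refine ENNReal.ofReal_le_ofReal ?_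
  push_cast
  linarith

lemma walk_le_of_lt_klUCB {a v c : ℝ} {t s f : ℕ} (hn : 1 ≤ s + f) (ha0 : 0 ≤ a) (hav : a < v)
    (hv1 : v < 1) (hs : a = 0 → s = 0) (hl : 0 ≤ level c t)
    (h : v < klUCB c t (s + f) (s / (s + f : ℝ))) : walk a v (s, f) ≤ level c t := by
  obtain ⟨u, hvu, hu1, hu⟩ := exists_of_lt_klUCB (by omega) (frac_mem_Icc s f) h
  exact walk_le_of_klBer_le hn ha0 hav hv1 hvu.le hu1.2 hs hl hu

lemma one_lt_log {t : ℕ} (ht : 3 ≤ t) : 1 < Real.log t := by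
  rw [Real.lt_log_iff_exp_lt (by positivity)]
  have : (3 : ℝ) ≤ t := by exact_mod_cast ht
  linarith [Real.exp_one_lt_d9]

lemma log_le_level {c : ℝ} (hc : 0 ≤ c) {t : ℕ} (ht : 3 ≤ t) : Real.log t ≤ level c t := by
  have := Real.log_nonneg (one_lt_log ht).le
  unfold level
  nlinarith

lemma level_le_mul_log {c : ℝ} (hc : 0 ≤ c) {t : ℕ} (ht : 3 ≤ t) :
    level c t ≤ (1 + c) * Real.log t := by
  have := Real.log_le_self (one_lt_log ht |>.trans' zero_lt_one).le
  unfold level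
  nlinarith

lemma level_mono {c : ℝ} (hc : 0 ≤ c) {t T : ℕ} (ht : 3 ≤ t) (h : t ≤ T) :
    level c t ≤ level c T := by
  have h1 : Real.log t ≤ Real.log T := Real.log_le_log (by positivity) (by exact_mod_cast h)
  have h2 : Real.log (Real.log t) ≤ Real.log (Real.log T) :=
    Real.log_le_log (by linarith [one_lt_log ht]) h1
  unfold level
  nlinarith

/-! ### The objective and the gaps -/

section Gaps

variable {N K : ℕ} {G : Matrix (Fin N) (Fin N) ℝ} {ε : ℝ} {α : Fin N → ℝ}
  {Astar : Finset (Fin N)}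

lemma slope_pos (hε : 0 < ε) : 0 < slope ε := by
  have : 1 < (1 + ε) / ε := (one_lt_div hε).2 (by linarith)
  have := Real.log_pos this
  unfold slope
  linarith

lemma objective_sub_objective (hε : 0 < ε) (w w' : Fin N → ℝ) (S : Finset (Fin N)) :
    objective G ε w S - objective G ε w' S = slope ε * ∑ i ∈ S, (w i - w' i) := by
  unfold objective
  rw [add_sub_add_left_eq_sub, ← Finset.sum_sub_distrib, Finset.mul_sum]
  refine Finset.sum_congr rfl fun i _ => ?_
  unfold relReward slope
  rw [Real.log_div (by linarith) hε.ne']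
  ring

lemma alphaPlus_le (hε : 0 < ε) (hK : 1 ≤ K) (hα : ∀ i, 0 ≤ α i) {S : Finset (Fin N)}
    (hS : S ∈ actions N K) {i : Fin N} (hi : i ∈ S) (hgap : 0 < gap G ε α Astar S) :
    alphaPlus G K ε α Astar i ≤ α i + gap G ε α Astar S / (K * slope ε) := by
  have hs := slope_pos hε
  have hK' : (0 : ℝ) < K := by exact_mod_cast hK
  have h1 : itemGap G K ε α Astar i ≤ ENNReal.ofReal (gap G ε α Astar S) := by
    refine iInf₂_le S ?_
    rw [Finset.mem_filter]
    exact ⟨hS, hi, by unfold gap at hgap; linarith⟩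
  have h2 : min 1 (ENNReal.ofReal (α i)
      + itemGap G K ε α Astar i / ENNReal.ofReal ((K : ℝ) * slope ε))
      ≤ ENNReal.ofReal (α i + gap G ε α Astar S / (K * slope ε)) := by
    rw [ENNReal.ofReal_add (hα i) (by positivity), ENNReal.ofReal_div_of_pos (by positivity)]
    exact (min_le_right _ _).trans (by gcongr)
  have h3 := ENNReal.toReal_mono ENNReal.ofReal_ne_top h2
  rwa [ENNReal.toReal_ofReal (add_nonneg (hα i) (by positivity))] at h3

lemma itemGap_pos (i : Fin N) : 0 < itemGap G K ε α Astar i := by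
  classical
  obtain ⟨δ, hδ, h⟩ : ∃ δ > 0, ∀ S ∈ {S ∈ actions N K | i ∈ S ∧
      objective G ε α S < objective G ε α Astar}, δ ≤ gap G ε α Astar S := by
    set F := {S ∈ actions N K | i ∈ S ∧ objective G ε α S < objective G ε α Astar} with hF
    rcases F.eq_empty_or_nonempty with h | h
    · exact ⟨1, one_pos, by simp [h]⟩
    · obtain ⟨S, hS, hmin⟩ := F.exists_min_image (gap G ε α Astar) h
      refine ⟨gap G ε α Astar S, ?_, hmin⟩
      have := (Finset.mem_filter.1 hS).2.2
      unfold gap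
      linarith
  exact (ENNReal.ofReal_pos.2 hδ).trans_le
    (le_iInf₂ fun S hS => ENNReal.ofReal_le_ofReal (h S hS))

lemma alphaPlus_le_one (i : Fin N) : alphaPlus G K ε α Astar i ≤ 1 := by
  have := ENNReal.toReal_mono ENNReal.one_ne_top (min_le_left 1 (ENNReal.ofReal (α i)
    + itemGap G K ε α Astar i / ENNReal.ofReal ((K : ℝ) * slope ε)))
  simpa [alphaPlus] using this

lemma lt_alphaPlus {i : Fin N} (h0 : 0 ≤ α i) (h1 : α i < 1) : α i < alphaPlus G K ε α Astar i := by
  have hlt : ENNReal.ofReal (α i) < min 1 (ENNReal.ofReal (α i)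
      + itemGap G K ε α Astar i / ENNReal.ofReal ((K : ℝ) * slope ε)) := by
    refine lt_min (by simpa using h1) (ENNReal.lt_add_right ENNReal.ofReal_ne_top ?_)
    exact (ENNReal.div_pos (itemGap_pos i).ne' ENNReal.ofReal_ne_top).ne'
  have := (ENNReal.toReal_lt_toReal ENNReal.ofReal_ne_top
    (ne_top_of_le_ne_top ENNReal.one_ne_top (min_le_left _ _))).2 hlt
  rwa [ENNReal.toReal_ofReal h0] at this

/-- If the indices of an optimal action do not fall short of the reliabilities by more than `η`,
then a suboptimal maximizer contains an item whose index is large. -/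
lemma exists_alphaPlus_sub_le (hε : 0 < ε) (hK : 1 ≤ K) (hα : ∀ i, 0 ≤ α i) {w : Fin N → ℝ} {η : ℝ}
    {S S' : Finset (Fin N)} (hS : IsArgmax G K ε w S) (hS' : S' ∈ actions N K)
    (hopt : gap G ε α Astar S' = 0) (hw : ∀ i ∈ S', α i - η ≤ w i)
    (hgap : 0 < gap G ε α Astar S) : ∃ j ∈ S, alphaPlus G K ε α Astar j - η ≤ w j := by
  have hs := slope_pos hε
  have hK' : (0 : ℝ) < K := by exact_mod_cast hK
  by_contra! hcon
  have card : ∀ S ∈ actions N K, S.card = K := fun S h => (Finset.mem_powersetCard.1 h).2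
  have hne : S.Nonempty := by
    rw [← Finset.card_pos, card S hS.1]; omega
  -- If every index in `S` were too small, optimism would add less than `gap - slope * K * η` to
  -- `S`. It subtracts at most `slope * K * η` from `S'`, so `S'` would beat `S`.
  have h1 : ∑ i ∈ S, (w i - α i) < ∑ i ∈ S, (gap G ε α Astar S / (K * slope ε) - η) := by
    refine Finset.sum_lt_sum_of_nonempty hne fun i hi => ?_
    have := alphaPlus_le hε hK hα hS.1 hi hgap
    linarith [hcon i hi]
  have h2 : ∑ i ∈ S', (-η) ≤ ∑ i ∈ S', (w i - α i) :=
    Finset.sum_le_sum fun i hi => by linarith [hw i hi]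
  rw [Finset.sum_const, card S hS.1, nsmul_eq_mul] at h1
  rw [Finset.sum_const, card S' hS', nsmul_eq_mul] at h2
  have h3 := objective_sub_objective (G := G) hε w α S
  have h4 := objective_sub_objective (G := G) hε w α S'
  have h5 := hS.2 S' hS'
  have h6 := mul_lt_mul_of_pos_left h1 hs
  have h7 := mul_le_mul_of_nonneg_left h2 hs.le
  have h8 : slope ε * (K * (gap G ε α Astar S / (K * slope ε) - η))
      = gap G ε α Astar S - slope ε * (K * η) := by field_simp
  unfold gap at *
  nlinarith

end Gaps

/-! ### The states that explain a suboptimal round -/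

/-- The states in which the log-likelihood walk runs at less than half its drift. -/
def slowSet (a q : ℝ) : Set (ℕ × ℕ) :=
  {x | walk a ((a + q) / 2) x ≤ klReal a ((a + q) / 2) / 2 * (x.1 + x.2)}

/-- The states in which an item with reliability `a` can have an index close to `q` while the
exploration level is at most `l`. -/
def pullSet (a q c l : ℝ) : Set (ℕ × ℕ) :=
  {x | q < 1 ∧ walk a q x ≤ l + 1} ∪ slowSet a q
    ∪ {x | q = 1 ∧ (x.2 : ℝ) ≤ 16 * (1 + c) + (1 - a) / 2 * (x.1 + x.2)}

/-- The states in which an item of reliability `a` with many observations has a low empirical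
mean. -/
def lowSet (a : ℝ) (t : ℕ) : Set (ℕ × ℕ) :=
  {x | √t ≤ x.1 + x.2 ∧ (x.1 : ℝ) ≤ (x.1 + x.2) * (a - (t : ℝ) ^ (-1 / 8 : ℝ))}

/-- The states in which the index of an item of reliability `a` can be less than `a - δ`. -/
def failSet (a δ : ℝ) (t : ℕ) : Set (ℕ × ℕ) :=
  {x | (x.1 : ℝ) < (x.1 + x.2) * (a - δ) ∧
    Real.log (t / 4) < (x.1 + x.2) * klReal (x.1 / (x.1 + x.2)) (a - δ)}

/-- The states that are unlikely to be visited at all. -/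
def visitSet (a q δ : ℝ) (N t : ℕ) : Set (ℕ × ℕ) :=
  {x | a = 0 ∧ 1 ≤ x.1} ∪ lowSet a t ∪ failSet a δ t
    ∪ {x | (t / (8 * N) : ℝ) ≤ x.1 + x.2 ∧ x ∈ slowSet a q}

/-- Raising `v` to `q` does not raise the success weight, and it raises the failure weight by `log
((1 - v) / (1 - q)) ≤ (q - v) / (1 - q)`. -/
lemma walk_le_walk_add {a v q : ℝ} (ha0 : 0 ≤ a) (ha1 : a < 1) (hv : 0 < v) (hvq : v ≤ q)
    (hq : q < 1) (x : ℕ × ℕ) :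
    walk a q x ≤ walk a v x + (q - v) / (1 - q) * (x.1 + x.2) := by
  have h1 : Real.log (a / q) ≤ Real.log (a / v) := by
    rcases ha0.eq_or_lt with rfl | ha
    · simp
    · exact Real.log_le_log (div_pos ha (by linarith)) (by gcongr)
  have h2 : Real.log ((1 - a) / (1 - q)) ≤ Real.log ((1 - a) / (1 - v)) + (q - v) / (1 - q) := by
    have h3 := Real.log_le_sub_one_of_pos (div_pos (by linarith : 0 < 1 - v) (by linarith : 0 < 1 - q))
    have h4 : (1 - v) / (1 - q) - 1 = (q - v) / (1 - q) := by
      have : 1 - q ≠ 0 := by linarith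
      field_simp
      ring
    rw [Real.log_div (by linarith) (by linarith)] at h3 ⊢
    rw [Real.log_div (by linarith) (by linarith)]
    linarith
  have h5 : 0 ≤ (q - v) / (1 - q) := div_nonneg (by linarith) (by linarith)
  have hs : (0 : ℝ) ≤ x.1 := Nat.cast_nonneg _
  have hf : (0 : ℝ) ≤ x.2 := Nat.cast_nonneg _
  unfold walk
  nlinarith [mul_le_mul_of_nonneg_right h1 hs, mul_le_mul_of_nonneg_right h2 hf, mul_nonneg h5 hs]

/-- Outside `slowSet`, the walk for the midpoint of `a` and `q` forces `n = O(log t)`. For `q < 1`,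
moving the walk from `q - 2 * η` to `q` then costs at most 1. The slack is `2 * η` because
`walk_le_of_lt_klUCB` needs a strict inequality. -/
lemma mem_pullSet {a q c η : ℝ} {t T s f : ℕ} (hc : 0 ≤ c) (ht : 3 ≤ t) (htT : t ≤ T) (ha0 : 0 ≤ a)
    (ha1 : a < 1) (haq : a < q) (hq1 : q ≤ 1) (hs : a = 0 → s = 0) (hη : 0 < η)
    (hη1 : 2 * η ≤ (q - a) / 2)
    (hη2 : q < 1 → 4 * (1 + c) / klReal a ((a + q) / 2) * Real.log t * η / (1 - q) ≤ 1)
    (hη3 : 4 * η < 1) (hη4 : Real.log t / 16 ≤ Real.log (1 / (4 * η)))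
    (hlog : 32 * Real.log 2 ≤ (1 - a) * Real.log t)
    (hU : q - η ≤ klUCB c t (s + f) (s / (s + f : ℝ))) : (s, f) ∈ pullSet a q c (level c T) := by
  have hl1 := one_lt_log ht
  have hlog_le := log_le_level hc ht
  have hle := level_le_mul_log hc ht
  have hl0 : 0 ≤ level c t := by linarith
  have hmono := level_mono hc ht htT
  by_cases hslow : (s, f) ∈ slowSet a q
  · exact Or.inl (Or.inr hslow)
  have hμ : 0 < klReal a ((a + q) / 2) := klReal_pos ha0 (by linarith) (by linarith)
  set μ := klReal a ((a + q) / 2) with hμd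
  have hn : 1 ≤ s + f := by
    by_contra hn
    obtain ⟨rfl, rfl⟩ : s = 0 ∧ f = 0 := by omega
    exact hslow (by simp [slowSet, walk])
  have hn0 : (0 : ℝ) ≤ s + f := by positivity
  have hslow' : μ / 2 * (s + f) < walk a ((a + q) / 2) (s, f) := not_le.1 hslow
  rcases hq1.lt_or_eq with hq | hq
  · refine Or.inl (Or.inl ⟨hq, ?_⟩)
    have h1 := walk_le_of_lt_klUCB (v := (a + q) / 2) hn ha0 (by linarith) (by linarith) hs hl0
      (by linarith)
    have h2 := walk_le_of_lt_klUCB (v := q - 2 * η) hn ha0 (by linarith) (by linarith) hs hl0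
      (by linarith)
    have h3 := walk_le_walk_add (v := q - 2 * η) ha0 ha1 (by linarith) (by linarith) hq (s, f)
    have h4 : (s + f : ℝ) ≤ 2 * (1 + c) / μ * Real.log t := by
      have : μ / 2 * (s + f) ≤ (1 + c) * Real.log t := by linarith
      rw [div_mul_eq_mul_div, le_div_iff₀ hμ]
      linarith
    have h5 : (q - (q - 2 * η)) / (1 - q) * (s + f : ℝ)
        ≤ (q - (q - 2 * η)) / (1 - q) * (2 * (1 + c) / μ * Real.log t) :=
      mul_le_mul_of_nonneg_left h4 (div_nonneg (by linarith) (by linarith))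
    have h6 : (q - (q - 2 * η)) / (1 - q) * (2 * (1 + c) / μ * Real.log t)
        = 4 * (1 + c) / μ * Real.log t * η / (1 - q) := by ring
    simp only at h3
    linarith [hη2 hq]
  · refine Or.inr ⟨hq, ?_⟩
    subst hq
    -- With reference parameter `1 / 2`, a failure contributes `log (1 / (4 * η)) ≥ log t / 16`,
    -- while a success subtracts at most `log 2`. Dividing by `log t` bounds the failures by a
    -- constant plus half their expected share.
    have h1 := walk_le_of_lt_klUCB (a := 1 / 2) (v := 1 - 2 * η) hn (by norm_num) (by linarith)
      (by linarith) (by norm_num) hl0 (by linarith)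
    have h2 : -Real.log 2 ≤ Real.log (1 / 2 / (1 - 2 * η)) := by
      rw [← Real.log_inv]
      refine Real.log_le_log (by norm_num) ?_
      rw [le_div_iff₀ (by linarith)]
      linarith
    have h3 : (1 - 1 / 2) / (1 - (1 - 2 * η)) = 1 / (4 * η) := by
      field_simp
      norm_num
      ring
    unfold walk at h1
    rw [h3] at h1
    simp only at h1 ⊢
    have hs0 : (0 : ℝ) ≤ s := Nat.cast_nonneg _
    have hf0 : (0 : ℝ) ≤ f := Nat.cast_nonneg _
    have h4 := mul_le_mul_of_nonneg_right h2 hs0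
    have h5 := mul_le_mul_of_nonneg_right hη4 hf0
    have h6 := mul_le_mul_of_nonneg_right hlog hn0
    have hlog2 : 0 < Real.log 2 := Real.log_pos (by norm_num)
    have h7 : Real.log t * f ≤ Real.log t * (16 * (1 + c) + (1 - a) / 2 * (s + f)) := by
      nlinarith
    exact le_of_mul_le_mul_left h7 (by linarith)

/-! ### Pathwise analysis of suboptimal rounds -/

section Path

variable {N K : ℕ} {G : Matrix (Fin N) (Fin N) ℝ} {ε c : ℝ} {α : Fin N → ℝ}
  {Astar : Finset (Fin N)}

lemma index_eq (A : ℕ → Finset (Fin N)) (z : ℕ → Fin N → Bool) (t : ℕ) (i : Fin N) :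
    index c A z t i = klUCB c t ((counts A z i (t - 1)).1 + (counts A z i (t - 1)).2)
      ((counts A z i (t - 1)).1 /
        ((counts A z i (t - 1)).1 + (counts A z i (t - 1)).2 : ℝ)) := by
  have := counts_add A z i (t - 1)
  unfold index empMean
  rw [← this]
  push_cast
  rfl

lemma card_pulls_lt_le (A : ℕ → Finset (Fin N)) (j : Fin N) (T m : ℕ) :
    {s ∈ Finset.Icc 1 T | j ∈ A s ∧ pulls A j (s - 1) < m}.card ≤ m := by
  have h : {s ∈ Finset.Icc 1 T | j ∈ A s ∧ pulls A j (s - 1) < m}.card ≤ min (pulls A j T) m := by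
    induction T with
    | zero => simp
    | succ T ih =>
      rw [card_filter_Icc_succ (fun s => j ∈ A s ∧ pulls A j (s - 1) < m), pulls_succ,
        add_tsub_cancel_right]
      by_cases hj : j ∈ A (T + 1) <;> by_cases hm : pulls A j T < m <;> simp [hj, hm] at ih ⊢ <;>
        omega
  exact h.trans (min_le_right _ _)

lemma card_le_pulls {A : ℕ → Finset (Fin N)} {S : Finset (Fin N)} {i : Fin N} (hi : i ∈ S) (t : ℕ) :
    {s ∈ Finset.Icc 1 t | A s = S}.card ≤ pulls A i t :=
  Finset.card_le_card fun s hs => by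
    simp only [Finset.mem_filter] at hs ⊢
    exact ⟨hs.1, hs.2 ▸ hi⟩

lemma gap_nonneg (hAstar : IsArgmax G K ε α Astar) {S : Finset (Fin N)} (hS : S ∈ actions N K) :
    0 ≤ gap G ε α Astar S := sub_nonneg.2 (hAstar.2 S hS)

/-- If no unlikely state is visited, some optimal action is selected often. -/
lemma exists_optimal_count {q : Fin N → ℝ} {δ : ℝ} (hε : 0 < ε) (hK : 1 ≤ K) (hc : 0 ≤ c)
    (hα0 : ∀ i, 0 ≤ α i) (hα1 : ∀ i, α i < 1) (hAstar : IsArgmax G K ε α Astar)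
    (hq : ∀ i, q i = alphaPlus G K ε α Astar i) (hδ0 : 0 < δ) (hδ : ∀ i, δ < (q i - α i) / 2)
    {t T : ℕ} (ht : 16 ≤ t) (htT : t ≤ T)
    (hlog : ∀ i, (1 + c) * Real.log t < klReal (α i) ((α i + q i) / 2) / 2 * (t / (8 * N)))
    (hcount : 2 ^ N * √t + N + 1 < 5 / 8 * (t : ℝ))
    {A : ℕ → Finset (Fin N)} {z : ℕ → Fin N → Bool}
    (hA : ∀ s ∈ Finset.Icc 1 T, IsArgmax G K ε (index c A z s) (A s))
    (hvisit : ∀ i, ∀ s ≤ T, counts A z i s ∉ visitSet (α i) (q i) δ N t) :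
    ∃ S ∈ actions N K, gap G ε α Astar S = 0 ∧
      √t ≤ ({s ∈ Finset.Icc 1 (t - 1) | A s = S}.card : ℝ) := by
  classical
  by_contra! hcon
  have htR : (16 : ℝ) ≤ t := by exact_mod_cast ht
  have hN : 0 < N := by
    rcases Nat.eq_zero_or_pos N with h | h
    · subst h
      have h1 := (Finset.mem_powersetCard.1 hAstar.1).2
      have h2 := Finset.card_le_univ Astar
      rw [Fintype.card_fin] at h2
      omega
    · exact h
  have hNR : (0 : ℝ) < N := by exact_mod_cast hN
  set k := ⌈(t / (8 * N) : ℝ)⌉₊ with hk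
  set J := {s ∈ Finset.Icc 1 (t - 1) | 4 * s < t} with hJ
  set O : Finset (Fin N) → Finset ℕ := fun S => {s ∈ Finset.Icc 1 (t - 1) | A s = S} with hO
  set P : Fin N → Finset ℕ := fun j =>
    {s ∈ Finset.Icc 1 (t - 1) | j ∈ A s ∧ pulls A j (s - 1) < k} with hP
  set Opt := {S ∈ actions N K | gap G ε α Astar S = 0} with hOpt
  -- A suboptimal round `s ≥ t / 4` selects an item whose index exceeds its midpoint, which is
  -- impossible after `k` pulls outside `slowSet`. The cover has at most `t / 4 + 2 ^ N * √t + (t /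
  -- 8 + N)` elements, and `1 - 1/4 - 1/8 = 5/8` is the constant in `hcount`.
  have hcover : Finset.Icc 1 (t - 1) ⊆ (J ∪ Opt.biUnion O) ∪ Finset.univ.biUnion P := by
    intro s hs
    have hs' := Finset.mem_Icc.1 hs
    have hsT : s ∈ Finset.Icc 1 T := Finset.mem_Icc.2 ⟨hs'.1, by omega⟩
    have hAs := hA s hsT
    by_cases h4 : 4 * s < t
    · exact Finset.mem_union_left _ (Finset.mem_union_left _ (Finset.mem_filter.2 ⟨hs, h4⟩))
    by_cases hg : gap G ε α Astar (A s) = 0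
    · refine Finset.mem_union_left _ (Finset.mem_union_right _ (Finset.mem_biUnion.2 ⟨A s, ?_, ?_⟩))
      · exact Finset.mem_filter.2 ⟨hAs.1, hg⟩
      · exact Finset.mem_filter.2 ⟨hs, rfl⟩
    refine Finset.mem_union_right _ ?_
    have hs3 : 3 ≤ s := by omega
    have hlevel := log_le_level hc hs3
    have hgpos := lt_of_le_of_ne (gap_nonneg hAstar hAs.1) (Ne.symm hg)
    have hU : ∀ i ∈ Astar, α i - δ ≤ index c A z s i := by
      intro i _
      by_contra! hlt
      rw [index_eq] at hlt
      obtain ⟨h1, h2⟩ := level_lt_of_klUCB_lt (by linarith [hα1 i]) hlt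
      refine hvisit i (s - 1) (by omega) (Or.inl (Or.inr ⟨h1, lt_of_le_of_lt ?_ h2⟩))
      refine le_trans (Real.log_le_log (by positivity) ?_) hlevel
      have : (t : ℝ) ≤ 4 * s := by exact_mod_cast not_lt.1 h4
      linarith
    obtain ⟨j, hj, hjU⟩ := exists_alphaPlus_sub_le hε hK hα0 hAs hAstar.1 (sub_self _) hU hgpos
    refine Finset.mem_biUnion.2 ⟨j, Finset.mem_univ _, Finset.mem_filter.2 ⟨hs, hj, ?_⟩⟩
    rw [← hq j, index_eq] at hjU
    have hv := hvisit j (s - 1) (by omega)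
    rw [← counts_add A z j (s - 1)]
    set x := counts A z j (s - 1) with hx
    have haq : α j < q j := by linarith [hδ j]
    have hq1 : q j ≤ 1 := by rw [hq j]; exact alphaPlus_le_one j
    by_contra! hxk
    have hxt : (t / (8 * N) : ℝ) ≤ x.1 + x.2 := by
      have := Nat.ceil_le.1 hxk
      exact_mod_cast this
    have hxn : 1 ≤ x.1 + x.2 := by
      have : 0 < k := Nat.ceil_pos.2 (by positivity)
      omega
    have hzero : α j = 0 → x.1 = 0 := fun h0 => by
      by_contra h1
      exact hv (Or.inl (Or.inl (Or.inl ⟨h0, by omega⟩)))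
    have hw := walk_le_of_lt_klUCB (v := (α j + q j) / 2) hxn (hα0 j) (by linarith)
      (by linarith [hα1 j]) hzero (by linarith [one_lt_log hs3]) (by linarith [hδ j])
    have hns : x ∉ slowSet (α j) (q j) := fun h => hv (Or.inr ⟨hxt, h⟩)
    have hns' : klReal (α j) ((α j + q j) / 2) / 2 * (x.1 + x.2) < walk (α j) ((α j + q j) / 2) x :=
      not_le.1 hns
    have hμ : 0 < klReal (α j) ((α j + q j) / 2) :=
      klReal_pos (hα0 j) (by linarith) (by linarith [hα1 j])
    have h5 := level_mono hc hs3 (show s ≤ t by omega)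
    have h6 := level_le_mul_log hc (show 3 ≤ t by omega)
    have h7 := mul_le_mul_of_nonneg_left hxt (half_pos hμ).le
    linarith [hlog j]
  have hcardJ : J.card ≤ t / 4 := by
    have : J ⊆ Finset.Icc 1 (t / 4) := fun s hs => by
      simp only [hJ, Finset.mem_filter, Finset.mem_Icc] at hs ⊢
      omega
    simpa using Finset.card_le_card this
  have hcardO : ((Opt.biUnion O).card : ℝ) ≤ 2 ^ N * √t := by
    calc ((Opt.biUnion O).card : ℝ) ≤ ∑ S ∈ Opt, ((O S).card : ℝ) := by
          exact_mod_cast Finset.card_biUnion_le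
      _ ≤ ∑ S ∈ Opt, √t := Finset.sum_le_sum fun S hS =>
          (hcon S (Finset.mem_filter.1 hS).1 (Finset.mem_filter.1 hS).2).le
      _ = Opt.card * √t := by rw [Finset.sum_const, nsmul_eq_mul]
      _ ≤ 2 ^ N * √t := by
          gcongr
          have := Finset.card_le_univ Opt
          simp only [Fintype.card_finset, Fintype.card_fin] at this
          exact_mod_cast this
  have hcardP : (Finset.univ.biUnion P).card ≤ N * k := by
    refine Finset.card_biUnion_le.trans ?_
    calc ∑ j, (P j).card ≤ ∑ _j : Fin N, k :=
          Finset.sum_le_sum fun j _ => card_pulls_lt_le A j (t - 1) k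
      _ = N * k := by simp
  have h1 := (Finset.card_le_card hcover).trans (Finset.card_union_le _ _)
  have h2 := Finset.card_union_le J (Opt.biUnion O)
  rw [Nat.card_Icc] at h1
  have h3 : (t : ℝ) - 1 ≤ (t / 4 : ℕ) + (Opt.biUnion O).card + (N * k : ℕ) := by
    have : t ≤ t / 4 + (Opt.biUnion O).card + N * k + 1 := by omega
    have : (t : ℝ) ≤ (t / 4 : ℕ) + (Opt.biUnion O).card + (N * k : ℕ) + 1 := by exact_mod_cast this
    linarith
  have h4 : ((t / 4 : ℕ) : ℝ) ≤ t / 4 := by exact_mod_cast Nat.cast_div_le (α := ℝ) (m := t) (n := 4)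
  have h5 : (k : ℝ) < t / (8 * N) + 1 := Nat.ceil_lt_add_one (by positivity)
  have h6 : ((N * k : ℕ) : ℝ) ≤ t / 8 + N := by
    push_cast
    calc (N : ℝ) * k ≤ N * (t / (8 * N) + 1) := by gcongr
      _ = t / 8 + N := by field_simp
  linarith

/-- A suboptimal round is explained by the state of one of its items or by an unlikely visit. -/
lemma exists_mem_pullSet_or_visitSet {q : Fin N → ℝ} {δ η : ℝ} (hε : 0 < ε) (hK : 1 ≤ K)
    (hc : 0 ≤ c) (hα0 : ∀ i, 0 ≤ α i) (hα1 : ∀ i, α i < 1) (hAstar : IsArgmax G K ε α Astar)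
    (hq : ∀ i, q i = alphaPlus G K ε α Astar i) (hδ0 : 0 < δ) (hδ : ∀ i, δ < (q i - α i) / 2)
    {t T : ℕ} (ht : 16 ≤ t) (htT : t ≤ T)
    (hlog : ∀ i, (1 + c) * Real.log t < klReal (α i) ((α i + q i) / 2) / 2 * (t / (8 * N)))
    (hcount : 2 ^ N * √t + N + 1 < 5 / 8 * (t : ℝ)) (hη : η = (t : ℝ) ^ (-1 / 8 : ℝ))
    (hη1 : ∀ i, 2 * η ≤ (q i - α i) / 2)
    (hη2 : ∀ i, q i < 1 →
      4 * (1 + c) / klReal (α i) ((α i + q i) / 2) * Real.log t * η / (1 - q i) ≤ 1)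
    (hη3 : 4 * η < 1) (hη4 : Real.log t / 16 ≤ Real.log (1 / (4 * η)))
    (hlog2 : ∀ i, 32 * Real.log 2 ≤ (1 - α i) * Real.log t)
    {A : ℕ → Finset (Fin N)} {z : ℕ → Fin N → Bool}
    (hA : ∀ s ∈ Finset.Icc 1 T, IsArgmax G K ε (index c A z s) (A s))
    (hgap : 0 < gap G ε α Astar (A t)) :
    (∃ j ∈ A t, counts A z j (t - 1) ∈ pullSet (α j) (q j) c (level c T)) ∨
      ∃ i, ∃ s ≤ T, counts A z i s ∈ visitSet (α i) (q i) δ N t := by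
  refine or_iff_not_imp_right.2 fun hvisit => ?_
  push Not at hvisit
  obtain ⟨S, hS, hopt, hSt⟩ := exists_optimal_count hε hK hc hα0 hα1 hAstar hq hδ0 hδ ht htT hlog
    hcount hA hvisit
  have hηpos : 0 < η := by
    rw [hη]
    exact Real.rpow_pos_of_pos (by exact_mod_cast (by omega : 0 < t)) _
  have htT' : t ∈ Finset.Icc 1 T := Finset.mem_Icc.2 ⟨by omega, htT⟩
  -- The index is never below the empirical mean, so `√t` observations outside `lowSet` suffice and
  -- no confidence bound is needed.
  have hU : ∀ i ∈ S, α i - η ≤ index c A z t i := by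
    intro i hi
    rw [index_eq]
    have hx := counts_add A z i (t - 1)
    have hv := hvisit i (t - 1) (by omega)
    set x := counts A z i (t - 1) with hxd
    have h1 : √t ≤ (x.1 + x.2 : ℝ) := by
      refine hSt.trans ?_
      have := card_le_pulls (A := A) hi (t - 1)
      rw [← hx] at this
      exact_mod_cast this
    have h2 : (x.1 + x.2 : ℝ) * (α i - η) < x.1 := by
      by_contra! hcon
      exact hv (Or.inl (Or.inl (Or.inr ⟨h1, by rwa [← hη]⟩)))
    have h3 : (0 : ℝ) < x.1 + x.2 :=
      lt_of_lt_of_le (Real.sqrt_pos.2 (by exact_mod_cast (by omega : 0 < t))) h1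
    refine le_trans ?_ (self_le_klUCB (frac_mem_Icc x.1 x.2))
    rw [le_div_iff₀ h3]
    linarith
  obtain ⟨j, hj, hjU⟩ := exists_alphaPlus_sub_le hε hK hα0 (hA t htT') hS hopt hU hgap
  refine ⟨j, hj, ?_⟩
  rw [← hq j, index_eq] at hjU
  have hv := hvisit j (t - 1) (by omega)
  refine mem_pullSet hc (by omega) htT (hα0 j) (hα1 j) (by linarith [hδ j])
    (by rw [hq j]; exact alphaPlus_le_one j) (fun h0 => ?_) hηpos (hη1 j) (hη2 j) hη3 hη4 (hlog2 j) hjU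
  by_contra h1
  exact hv (Or.inl (Or.inl (Or.inl ⟨h0, Nat.pos_of_ne_zero h1⟩)))

end Path

/-! ### Expected visits to the explaining states -/

/-- Subtracting `μ / 2` from each increment leaves a walk of drift `μ / 2 > 0`, and the slow states
are those where it is not positive. -/
lemma occBound_slowSet {a q : ℝ} (ha0 : 0 ≤ a) (ha1 : a < 1) (haq : a < q) (hq1 : q ≤ 1) :
    ∃ κ > 0, ∀ n₀ : ℕ, OccBound a ({x : ℕ × ℕ | n₀ ≤ x.1 + x.2 ∧ x ∈ slowSet a q}.indicator 1)
      (ENNReal.ofReal (Real.exp (-(κ * n₀)) / (1 - Real.exp (-κ)))) := by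
  have hμ : 0 < klReal a ((a + q) / 2) := klReal_pos ha0 (by linarith) (by linarith)
  set m := (a + q) / 2 with hm
  set μ := klReal a m with hμd
  obtain ⟨l, -, κ, hκ, h⟩ := occBound_halfspace (A := Real.log (a / m) - μ / 2)
    (B := Real.log ((1 - a) / (1 - m)) - μ / 2) ⟨ha0, ha1.le⟩ (by
      have : a * (Real.log (a / m) - μ / 2) + (1 - a) * (Real.log ((1 - a) / (1 - m)) - μ / 2)
        = μ - μ / 2 := by rw [hμd, klReal]; ring
      rw [this]; linarith)
  refine ⟨κ, hκ, fun n₀ => (h 0 n₀).mono ?_ (by simp)⟩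
  refine Set.indicator_le_indicator_of_subset (fun x hx => ⟨hx.1, ?_⟩) (fun _ => zero_le)
  have h2 : walk a m x ≤ μ / 2 * (x.1 + x.2) := hx.2
  unfold walk at h2
  linarith

lemma occBound_pullSet {a q c : ℝ} (ha0 : 0 ≤ a) (ha1 : a < 1) (haq : a < q) (hq1 : q ≤ 1) :
    ∃ C : ℝ, ∀ l ≥ 0, OccBound a ((pullSet a q c l).indicator 1)
      (ENNReal.ofReal l / klBer a q + ENNReal.ofReal C) := by
  obtain ⟨κ, hκ, hslow⟩ := occBound_slowSet ha0 ha1 haq hq1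
  obtain ⟨l₃, -, κ₃, hκ₃, h₃⟩ := occBound_halfspace (a := a) (A := -((1 - a) / 2))
    (B := 1 - (1 - a) / 2) ⟨ha0, ha1.le⟩ (by nlinarith)
  have hren : ∃ C ≥ 0, ∀ l ≥ 0, OccBound a ({x | q < 1 ∧ walk a q x ≤ l + 1}.indicator 1)
      (ENNReal.ofReal l / klBer a q + ENNReal.ofReal C) := by
    rcases hq1.lt_or_eq with hq | hq
    · have hμ : 0 < klReal a q := klReal_pos ha0 haq hq
      obtain ⟨C, hC, h⟩ := occBound_renewal (A := Real.log (a / q))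
        (B := Real.log ((1 - a) / (1 - q))) ⟨ha0, ha1.le⟩ hμ
      refine ⟨1 / klReal a q + C, by positivity, fun l hl => (h (l + 1) (by positivity)).mono ?_ ?_⟩
      · exact Set.indicator_le_indicator_of_subset (fun x hx => hx.2) (fun _ => zero_le)
      · rw [klBer_eq_ofReal (by linarith) hq.ne, ← ENNReal.ofReal_div_of_pos hμ,
          ← ENNReal.ofReal_add (by positivity) (by positivity)]
        refine ENNReal.ofReal_le_ofReal (le_of_eq ?_)
        change (l + 1) / klReal a q + C = _
        ring
    -- For `q = 1` this part of `pullSet` is empty, so nothing grows with `l`.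
    · refine ⟨0, le_rfl, fun l _ => ⟨0, fun s f => ?_, by simp⟩⟩
      simp [hq]
  obtain ⟨C, hC, h₁⟩ := hren
  set C₂ := Real.exp (-(κ * (0 : ℕ))) / (1 - Real.exp (-κ)) with hC₂
  set C₃ := Real.exp (l₃ * (16 * (1 + c))) * (Real.exp (-(κ₃ * (0 : ℕ))) / (1 - Real.exp (-κ₃)))
    with hC₃
  have hlt : ∀ k : ℝ, 0 < k → 0 ≤ 1 - Real.exp (-k) := fun k hk => by
    have : Real.exp (-k) ≤ 1 := Real.exp_le_one_iff.2 (by linarith)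
    linarith
  have hC₂0 : 0 ≤ C₂ := div_nonneg (Real.exp_nonneg _) (hlt κ hκ)
  have hC₃0 : 0 ≤ C₃ := mul_nonneg (Real.exp_nonneg _) (div_nonneg (Real.exp_nonneg _) (hlt κ₃ hκ₃))
  refine ⟨C + C₂ + C₃, fun l hl => OccBound.mono (((h₁ l hl).union ((hslow 0).mono ?_ le_rfl)).union
    ((h₃ (16 * (1 + c)) 0).mono ?_ le_rfl)) le_rfl ?_⟩
  · exact Set.indicator_le_indicator_of_subset (fun x hx => ⟨Nat.zero_le _, hx⟩) (fun _ => zero_le)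
  · refine Set.indicator_le_indicator_of_subset (fun x hx => ⟨Nat.zero_le _, ?_⟩) (fun _ => zero_le)
    have := hx.2
    linarith
  · rw [ENNReal.ofReal_add (by positivity) hC₃0, ENNReal.ofReal_add hC hC₂0]
    refine le_of_eq ?_
    ring

/-- Chernoff with exponent `l = η` has rate `η ^ 2 / 2` per observation. With `y = t ^ (1/4)` one
has `η ^ 2 = 1 / y` and `√t = y ^ 2`, so the tail is at most `exp (-y / 2) ≤ 9! * 2 ^ 9 / y ^ 9`.
The geometric sum costs a factor `4 * y`, which leaves `y ^ (-8) = t ^ (-2)`. -/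
lemma occBound_lowSet {a : ℝ} (ha0 : 0 ≤ a) (ha1 : a ≤ 1) {t : ℕ} (ht : 1 ≤ t) :
    OccBound a ((lowSet a t).indicator 1)
      (ENNReal.ofReal (4 * (Nat.factorial 9) * 2 ^ 9 * (t : ℝ) ^ (-2 : ℝ))) := by
  have htpos : (0 : ℝ) < t := by exact_mod_cast ht
  set y : ℝ := (t : ℝ) ^ (1 / 4 : ℝ) with hy
  set η : ℝ := (t : ℝ) ^ (-1 / 8 : ℝ) with hη
  have hy0 : 0 < y := Real.rpow_pos_of_pos htpos _
  have hη0 : 0 < η := Real.rpow_pos_of_pos htpos _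
  have hηy : η ^ 2 = y⁻¹ := by
    rw [hη, hy, ← Real.rpow_natCast, ← Real.rpow_mul htpos.le, ← Real.rpow_neg htpos.le]
    norm_num
  have hy2 : √t = y ^ 2 := by
    rw [hy, ← Real.rpow_natCast, ← Real.rpow_mul htpos.le, Real.sqrt_eq_rpow]
    norm_num
  have hy8 : (t : ℝ) ^ (-2 : ℝ) = (y ^ 8)⁻¹ := by
    rw [hy, ← Real.rpow_natCast, ← Real.rpow_mul htpos.le, ← Real.rpow_neg htpos.le]
    norm_num
  have hη1 : η ≤ 1 := Real.rpow_le_one_of_one_le_of_nonpos (by exact_mod_cast ht) (by norm_num)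
  have hy1 : 1 ≤ y := Real.one_le_rpow (by exact_mod_cast ht) (by norm_num)
  have hmoment : a * Real.exp (-(η * (1 - a + η))) + (1 - a) * Real.exp (-(η * (-(a - η))))
      ≤ Real.exp (-(η ^ 2 / 2)) := by
    have h1 : Real.exp (-(η * (1 - a))) ≤ 1 - η * (1 - a) + (η * (1 - a)) ^ 2 := by
      have := (abs_le.1 (Real.abs_exp_sub_one_sub_id_le (x := -(η * (1 - a))) (by
        rw [abs_neg, abs_of_nonneg (mul_nonneg hη0.le (by linarith))]; nlinarith))).2
      linarith
    have h2 : Real.exp (η * a) ≤ 1 + η * a + (η * a) ^ 2 := by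
      have := (abs_le.1 (Real.abs_exp_sub_one_sub_id_le (x := η * a) (by
        rw [abs_of_nonneg (mul_nonneg hη0.le ha0)]; nlinarith))).2
      linarith
    have h3 : a * Real.exp (-(η * (1 - a))) + (1 - a) * Real.exp (η * a) ≤ Real.exp (η ^ 2 / 2) := by
      have := Real.add_one_le_exp (η ^ 2 / 2)
      have h4 := mul_le_mul_of_nonneg_left h1 ha0
      have h5 := mul_le_mul_of_nonneg_left h2 (sub_nonneg.2 ha1)
      have h6 : a * (1 - η * (1 - a) + (η * (1 - a)) ^ 2) + (1 - a) * (1 + η * a + (η * a) ^ 2)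
          = 1 + η ^ 2 * (a * (1 - a)) := by ring
      have h7 : a * (1 - a) ≤ 1 / 2 := by nlinarith [sq_nonneg (a - 1 / 2)]
      have h8 := mul_le_mul_of_nonneg_left h7 (sq_nonneg η)
      linarith
    have e1 : Real.exp (-(η * (1 - a + η))) = Real.exp (-(η * (1 - a))) * Real.exp (-η ^ 2) := by
      rw [← Real.exp_add]; ring_nf
    have e2 : Real.exp (-(η * (-(a - η)))) = Real.exp (η * a) * Real.exp (-η ^ 2) := by
      rw [← Real.exp_add]; ring_nf
    have e3 : Real.exp (-(η ^ 2 / 2)) = Real.exp (η ^ 2 / 2) * Real.exp (-η ^ 2) := by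
      rw [← Real.exp_add]; ring_nf
    rw [e1, e2, e3, ← mul_assoc, ← mul_assoc, ← add_mul]
    exact mul_le_mul_of_nonneg_right h3 (Real.exp_nonneg _)
  have hκ : 0 < η ^ 2 / 2 := by positivity
  refine (occBound_halfspace_of_exp_moment_le ⟨ha0, ha1⟩ hη0.le hκ hmoment 0 ⌈√t⌉₊).mono ?_ ?_
  · refine Set.indicator_le_indicator_of_subset (fun x hx => ⟨?_, ?_⟩) (fun _ => zero_le)
    · refine Nat.ceil_le.2 ?_
      push_cast
      exact hx.1
    · have h2 : (x.1 : ℝ) ≤ (x.1 + x.2) * (a - η) := hx.2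
      linarith
  · refine ENNReal.ofReal_le_ofReal ?_
    rw [mul_zero, Real.exp_zero, one_mul]
    have hden : η ^ 2 / 4 ≤ 1 - Real.exp (-(η ^ 2 / 2)) := by
      have hle : η ^ 2 / 2 ≤ 1 / 2 := by nlinarith
      have := (abs_le.1 (Real.abs_exp_sub_one_sub_id_le (x := -(η ^ 2 / 2)) (by
        rw [abs_neg, abs_of_pos hκ]; linarith))).2
      nlinarith
    have hnum : Real.exp (-(η ^ 2 / 2 * ⌈√t⌉₊)) ≤ Nat.factorial 9 * 2 ^ 9 / y ^ 9 := by
      have h1 : y / 2 ≤ η ^ 2 / 2 * ⌈√t⌉₊ := by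
        have : y ^ 2 ≤ (⌈√t⌉₊ : ℝ) := hy2 ▸ Nat.le_ceil _
        calc y / 2 = η ^ 2 / 2 * y ^ 2 := by rw [hηy]; field_simp
          _ ≤ _ := by gcongr
      have h2 := Real.pow_div_factorial_le_exp (y / 2) (by positivity) 9
      calc Real.exp (-(η ^ 2 / 2 * ⌈√t⌉₊)) ≤ Real.exp (-(y / 2)) :=
            Real.exp_le_exp.2 (by linarith)
        _ = (Real.exp (y / 2))⁻¹ := Real.exp_neg _
        _ ≤ ((y / 2) ^ 9 / Nat.factorial 9)⁻¹ := inv_anti₀ (by positivity) h2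
        _ = _ := by field_simp
    calc Real.exp (-(η ^ 2 / 2 * ⌈√t⌉₊)) / (1 - Real.exp (-(η ^ 2 / 2)))
        ≤ (Nat.factorial 9 * 2 ^ 9 / y ^ 9) / (η ^ 2 / 4) := by gcongr
      _ = _ := by rw [hηy, hy8]; field_simp

lemma pow_eq_exp_mul_log {x : ℝ} {n : ℕ} (hx : 0 ≤ x) (h : x = 0 → n = 0) :
    x ^ n = Real.exp (n * Real.log x) := by
  rcases hx.eq_or_lt with h0 | h0
  · simp [h h0.symm]
  · rw [Real.exp_nat_mul, Real.exp_log h0]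

/-- The difference of the two sides is `(p - v) * (log (v / a) - log ((1 - v) / (1 - a)))`, a
product of two nonpositive factors. -/
lemma klReal_add_le {p v a : ℝ} (hp0 : 0 ≤ p) (hpv : p ≤ v) (hva : v < a) (ha : a < 1) :
    klReal p v + klReal v a ≤ klReal p a := by
  rcases hpv.eq_or_lt with rfl | hpv
  · simp [klReal_self]
  have h1 : p * Real.log (p / a) = p * Real.log (p / v) + p * Real.log (v / a) := by
    rcases hp0.eq_or_lt with rfl | hp
    · simp
    · rw [Real.log_div hp.ne' (by linarith), Real.log_div hp.ne' (by linarith),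
        Real.log_div (by linarith) (by linarith)]
      ring
  have h2 : (1 - p) * Real.log ((1 - p) / (1 - a)) = (1 - p) * Real.log ((1 - p) / (1 - v))
      + (1 - p) * Real.log ((1 - v) / (1 - a)) := by
    rw [Real.log_div (by linarith) (by linarith), Real.log_div (by linarith) (by linarith),
      Real.log_div (by linarith) (by linarith)]
    ring
  have h3 : Real.log (v / a) ≤ 0 :=
    Real.log_nonpos (div_nonneg (by linarith) (by linarith))
      (div_le_one_of_le₀ hva.le (by linarith))
  have h4 : 0 ≤ Real.log ((1 - v) / (1 - a)) :=
    Real.log_nonneg ((one_le_div (by linarith)).2 (by linarith))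
  unfold klReal
  rw [h1, h2]
  nlinarith

lemma klReal_le_neg_log {p v : ℝ} (hp0 : 0 ≤ p) (hpv : p ≤ v) (hv0 : 0 < v) (hv : v < 1) :
    klReal p v ≤ -Real.log (1 - v) := by
  have h1 : p * Real.log (p / v) ≤ 0 :=
    mul_nonpos_of_nonneg_of_nonpos hp0
      (Real.log_nonpos (by positivity) (div_le_one_of_le₀ hpv hv0.le))
  have h2 : Real.log ((1 - p) / (1 - v)) ≤ -Real.log (1 - v) := by
    rw [Real.log_div (by linarith) (by linarith)]
    linarith [Real.log_nonpos (by linarith : 0 ≤ 1 - p) (by linarith)]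
  have h3 : 0 ≤ Real.log ((1 - p) / (1 - v)) :=
    Real.log_nonneg ((one_le_div (by linarith)).2 (by linarith))
  unfold klReal
  nlinarith

/-- A state of frequency `p` has probability at most `exp (-n * kl(p ‖ a))`. With `v = a - δ` and `κ
= kl(v ‖ a)` the exponent is at least `n * kl(p ‖ v) + n * κ`, whose first term exceeds `log (t /
4)`. Half of `n * κ` makes the sum over states converge; the other half gives the extra power of
`t`. -/
lemma occBound_failSet {a δ : ℝ} (ha0 : 0 ≤ a) (ha1 : a < 1) (hδ : 0 < δ) :
    ∃ γ : ℝ, 0 < γ ∧ ∃ C : ℝ≥0∞, C ≠ ⊤ ∧ ∀ t : ℕ, 1 ≤ t → OccBound a ((failSet a δ t).indicator 1)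
      (ENNReal.ofReal ((t / 4 : ℝ) ^ (-(1 + γ))) * C) := by
  rcases le_or_gt (a - δ) 0 with hv | hv0
  · refine ⟨1, one_pos, 0, by simp, fun t _ => ⟨0, fun s f => ?_, by simp⟩⟩
    have : (s, f) ∉ failSet a δ t := fun h => by
      have h1 := h.1
      simp only at h1
      have : (s + f : ℝ) * (a - δ) ≤ 0 := mul_nonpos_of_nonneg_of_nonpos (by positivity) hv
      linarith [Nat.cast_nonneg (α := ℝ) s]
    simp [this]
  have hva : a - δ < a := by linarith
  have ha : 0 < a := by linarith
  set v := a - δ with hvd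
  set κ := klReal v a with hκd
  have hκ : 0 < κ := klReal_pos hv0.le hva ha1
  set Λ := -Real.log (1 - v) with hΛd
  have hΛ : 0 < Λ := neg_pos.2 (Real.log_neg (by linarith) (by linarith))
  set R := ENNReal.ofReal (Real.exp (-(κ / 2))) with hR
  have hR1 : R < 1 := by
    rw [hR, ENNReal.ofReal_lt_one, ← Real.exp_zero]
    exact Real.exp_lt_exp.2 (by linarith)
  refine ⟨κ / (2 * Λ), by positivity, (1 - R)⁻¹ * (1 - R)⁻¹, ?_, fun t ht => ?_⟩
  · have : (1 - R)⁻¹ ≠ ⊤ := ENNReal.inv_ne_top.2 (tsub_pos_of_lt hR1).ne'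
    exact ENNReal.mul_ne_top this this
  have ht4 : (0 : ℝ) < t / 4 := by
    have : (0 : ℝ) < t := by exact_mod_cast ht
    positivity
  have point : ∀ x : ℕ × ℕ, OccBound a ((failSet a δ t ∩ {x}).indicator 1)
      (ENNReal.ofReal ((t / 4 : ℝ) ^ (-(1 + κ / (2 * Λ)))) * (R ^ x.1 * R ^ x.2)) := by
    rintro ⟨s, f⟩
    by_cases hx : (s, f) ∈ failSet a δ t
    swap
    · refine ⟨0, fun s' f' => ?_, by simp⟩
      have : (s', f') ∉ failSet a δ t ∩ {(s, f)} := fun h => hx (by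
        have h2 : (s', f') = (s, f) := h.2
        rw [← h2]; exact h.1)
      simp [this]
    refine (occBound_singleton ha ha1 s f).mono
      (Set.indicator_le_indicator_of_subset Set.inter_subset_right (fun _ => zero_le)) ?_
    obtain ⟨h1, h2⟩ := hx
    simp only at h1 h2
    have hn : (0 : ℝ) < s + f := by
      by_contra hcon
      have h0 : (s + f : ℝ) = 0 := le_antisymm (not_lt.1 hcon) (by positivity)
      rw [h0, zero_mul] at h1
      linarith [Nat.cast_nonneg (α := ℝ) s]
    have hp := frac_mem_Icc s f
    have hf : (f / (s + f : ℝ)) = 1 - s / (s + f : ℝ) := by field_simp; ring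
    have hpv : s / (s + f : ℝ) < v := by rwa [div_lt_iff₀' hn]
    have hsn : (s : ℝ) = (s + f) * (s / (s + f : ℝ)) := by field_simp
    have hfn : (f : ℝ) = (s + f) * (1 - s / (s + f : ℝ)) := by field_simp; ring
    have hexp : (s / (s + f : ℝ) / a) ^ s * (f / (s + f : ℝ) / (1 - a)) ^ f
        = Real.exp ((s + f) * klReal (s / (s + f : ℝ)) a) := by
      rw [pow_eq_exp_mul_log (div_nonneg hp.1 ha0), pow_eq_exp_mul_log, ← Real.exp_add, hf]
      · congr 1
        unfold klReal
        rw [mul_add, ← mul_assoc, ← mul_assoc, ← hsn, ← hfn]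
      · exact div_nonneg (by positivity) (by linarith)
      · intro h
        rcases div_eq_zero_iff.1 h with h | h
        · rcases div_eq_zero_iff.1 h with h | h
          · exact_mod_cast h
          · linarith
        · linarith
      · intro h
        rcases div_eq_zero_iff.1 h with h | h
        · rcases div_eq_zero_iff.1 h with h | h
          · exact_mod_cast h
          · linarith
        · linarith
    rw [hexp, ← Real.exp_neg, hR, ← ENNReal.ofReal_pow (Real.exp_nonneg _),
      ← ENNReal.ofReal_pow (Real.exp_nonneg _), ← ENNReal.ofReal_mul (by positivity),
      ← ENNReal.ofReal_mul (by positivity), Real.rpow_def_of_pos ht4, ← Real.exp_nat_mul,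
      ← Real.exp_nat_mul, ← Real.exp_add, ← Real.exp_add]
    refine ENNReal.ofReal_le_ofReal (Real.exp_le_exp.2 ?_)
    set p := s / (s + f : ℝ) with hpd
    set L := Real.log (t / 4 : ℝ) with hL
    have h3 := mul_le_mul_of_nonneg_left (klReal_add_le hp.1 hpv.le hva ha1) hn.le
    have h4 := mul_le_mul_of_nonneg_left (klReal_le_neg_log hp.1 hpv.le hv0 (by linarith)) hn.le
    -- Since `kl(p ‖ v) ≤ Λ`, the failure condition forces `n ≥ L / Λ`: few observations cannot push
    -- the index that low.
    have h5 : L * (κ / (2 * Λ)) ≤ (s + f) * (κ / 2) := by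
      have : L ≤ (s + f) * Λ := by linarith
      calc L * (κ / (2 * Λ)) ≤ ((s + f) * Λ) * (κ / (2 * Λ)) := by gcongr
        _ = (s + f) * (κ / 2) := by field_simp
    linarith
  have htsum : ∑' x : ℕ × ℕ, ENNReal.ofReal ((t / 4 : ℝ) ^ (-(1 + κ / (2 * Λ))))
      * (R ^ x.1 * R ^ x.2)
      = ENNReal.ofReal ((t / 4 : ℝ) ^ (-(1 + κ / (2 * Λ)))) * ((1 - R)⁻¹ * (1 - R)⁻¹) := by
    rw [ENNReal.tsum_mul_left, ENNReal.tsum_prod (f := fun s f => R ^ s * R ^ f)]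
    simp_rw [ENNReal.tsum_mul_left, ENNReal.tsum_mul_right, ENNReal.tsum_geometric]
  rw [← htsum]
  refine (OccBound.tsum point).mono (fun x => ?_) le_rfl
  refine le_trans ?_ (ENNReal.le_tsum x)
  by_cases hx : x ∈ failSet a δ t <;> simp [hx]

lemma tsum_ofReal_rpow_ne_top {γ : ℝ} (hγ : 0 < γ) {b : ℝ} (hb : 0 ≤ b) :
    ∑' t : ℕ, ENNReal.ofReal ((t / b : ℝ) ^ (-(1 + γ))) ≠ ⊤ := by
  have : Summable fun t : ℕ => (t : ℝ) ^ (-(1 + γ)) := Real.summable_nat_rpow.2 (by linarith)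
  simp_rw [Real.div_rpow (Nat.cast_nonneg _) hb]
  exact (this.div_const _).tsum_ofReal_ne_top

lemma occBound_visitSet {a q δ : ℝ} {N : ℕ} (hN : 0 < N) (ha0 : 0 ≤ a) (ha1 : a < 1) (haq : a < q)
    (hq1 : q ≤ 1) (hδ : 0 < δ) :
    ∃ b : ℕ → ℝ≥0∞, ∑' t, b t ≠ ⊤ ∧
      ∀ t : ℕ, 1 ≤ t → OccBound a ((visitSet a q δ N t).indicator 1) (b t) := by
  obtain ⟨γ, hγ, C, hC, hfail⟩ := occBound_failSet ha0 ha1 hδ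
  obtain ⟨κ, hκ, hslow⟩ := occBound_slowSet ha0 ha1 haq hq1
  have hNR : (0 : ℝ) < N := by exact_mod_cast hN
  have hden : 0 < 1 - Real.exp (-κ) := by
    have : Real.exp (-κ) < Real.exp 0 := Real.exp_lt_exp.2 (by linarith)
    rw [Real.exp_zero] at this
    linarith
  refine ⟨fun t => 0 + ENNReal.ofReal (4 * (Nat.factorial 9) * 2 ^ 9 * (t : ℝ) ^ (-2 : ℝ))
    + ENNReal.ofReal ((t / 4 : ℝ) ^ (-(1 + γ))) * C
    + ENNReal.ofReal (Real.exp (-(κ / (8 * N))) ^ t / (1 - Real.exp (-κ))), ?_, fun t ht => ?_⟩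
  · rw [ENNReal.tsum_add, ENNReal.tsum_add, ENNReal.tsum_add, ENNReal.tsum_mul_right, tsum_zero,
      zero_add]
    refine ENNReal.add_ne_top.2 ⟨ENNReal.add_ne_top.2 ⟨?_, ENNReal.mul_ne_top ?_ hC⟩, ?_⟩
    · exact ((Real.summable_nat_rpow.2 (by norm_num)).mul_left _).tsum_ofReal_ne_top
    · exact tsum_ofReal_rpow_ne_top hγ (by norm_num)
    · refine ((summable_geometric_of_lt_one (Real.exp_nonneg _) ?_).div_const _).tsum_ofReal_ne_top
      rw [← Real.exp_zero]
      exact Real.exp_lt_exp.2 (neg_lt_zero.2 (by positivity))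
  · refine (((occBound_success_of_eq_zero.union (occBound_lowSet ha0 ha1.le ht)).union
      (hfail t ht)).union ((hslow ⌈(t / (8 * N) : ℝ)⌉₊).mono ?_ ?_))
    · refine Set.indicator_le_indicator_of_subset (fun x hx => ⟨Nat.ceil_le.2 ?_, hx.2⟩)
        (fun _ => zero_le)
      push_cast
      exact hx.1
    · refine ENNReal.ofReal_le_ofReal ?_
      gcongr
      rw [← Real.exp_nat_mul]
      refine Real.exp_le_exp.2 ?_
      have := mul_le_mul_of_nonneg_left (Nat.le_ceil (t / (8 * N) : ℝ)) hκ.le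
      have e : (t : ℝ) * -(κ / (8 * N)) = -(κ * (t / (8 * N))) := by ring
      rw [e]
      linarith

/-! ### Growth comparisons for large `t` -/

lemma eventually_mul_log_lt {b C : ℝ} (hb : 0 < b) :
    ∀ᶠ t : ℕ in Filter.atTop, C * Real.log t < b * t := by
  have h : Filter.Tendsto (fun t : ℝ => C * (Real.log t / t)) Filter.atTop (nhds (C * 0)) :=
    (Real.isLittleO_log_id_atTop.tendsto_div_nhds_zero).const_mul C
  rw [mul_zero] at h
  have h' := (h.comp tendsto_natCast_atTop_atTop).eventually_lt_const hb
  filter_upwards [h', Filter.eventually_gt_atTop 0] with t ht ht0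
  have ht0 : (0 : ℝ) < t := by exact_mod_cast ht0
  have : C * Real.log t / t < b := by rwa [mul_div_assoc]
  rwa [div_lt_iff₀ ht0] at this

lemma eventually_mul_sqrt_add_lt {b C D : ℝ} (hb : 0 < b) :
    ∀ᶠ t : ℕ in Filter.atTop, C * √t + D < b * t := by
  have h1 : Filter.Tendsto (fun t : ℕ => √(t : ℝ)) Filter.atTop Filter.atTop :=
    Real.tendsto_sqrt_atTop.comp tendsto_natCast_atTop_atTop
  filter_upwards [h1.eventually_gt_atTop ((|C| + |D|) / b), h1.eventually_gt_atTop 1] with t h2 h3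
  rw [div_lt_iff₀ hb] at h2
  have h4 : √(t : ℝ) * √t = t := Real.mul_self_sqrt (Nat.cast_nonneg _)
  nlinarith [le_abs_self C, le_abs_self D, abs_nonneg D, mul_lt_mul_of_pos_right h2 (show 0 < √(t:ℝ) by linarith),
    mul_le_mul_of_nonneg_right (le_abs_self C) (show 0 ≤ √(t:ℝ) by linarith),
    mul_le_mul_of_nonneg_left h3.le (abs_nonneg D)]

lemma eventually_mul_rpow_neg_le {b C : ℝ} (hb : 0 < b) :
    ∀ᶠ t : ℕ in Filter.atTop, C * (t : ℝ) ^ (-1 / 8 : ℝ) < b := by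
  have h : Filter.Tendsto (fun t : ℝ => C * t ^ (-(1 / 8) : ℝ)) Filter.atTop (nhds (C * 0)) :=
    (tendsto_rpow_neg_atTop (by norm_num)).const_mul C
  rw [mul_zero] at h
  have h' := (h.comp tendsto_natCast_atTop_atTop).eventually_lt_const hb
  filter_upwards [h'] with t ht
  rwa [neg_div]

lemma eventually_mul_log_mul_rpow_neg_le {b C : ℝ} (hb : 0 < b) :
    ∀ᶠ t : ℕ in Filter.atTop, C * Real.log t * (t : ℝ) ^ (-1 / 8 : ℝ) < b := by
  have h : Filter.Tendsto (fun t : ℝ => C * (Real.log t / t ^ (1 / 8 : ℝ))) Filter.atTop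
      (nhds (C * 0)) :=
    ((isLittleO_log_rpow_atTop (by norm_num)).tendsto_div_nhds_zero).const_mul C
  rw [mul_zero] at h
  have h' := (h.comp tendsto_natCast_atTop_atTop).eventually_lt_const hb
  filter_upwards [h'] with t ht
  rwa [neg_div, Real.rpow_neg (Nat.cast_nonneg _), mul_assoc, ← div_eq_mul_inv]

lemma eventually_lt_log (C : ℝ) : ∀ᶠ t : ℕ in Filter.atTop, C < Real.log t :=
  (Real.tendsto_log_atTop.comp tendsto_natCast_atTop_atTop).eventually_gt_atTop C

/-! ### Assembling the regret bound -/

section Regret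

variable {N K : ℕ} {G : Matrix (Fin N) (Fin N) ℝ} {ε c : ℝ} {α : Fin N → ℝ}
  {Astar : Finset (Fin N)}

/-- From some round on, a suboptimal round is explained by the state of one of its items or by an
unlikely visit. -/
lemma exists_forall_mem_pullSet_or_visitSet {q : Fin N → ℝ} {δ : ℝ} (hε : 0 < ε) (hK : 1 ≤ K)
    (hc : 0 ≤ c) (hN : 0 < N) (hα0 : ∀ i, 0 ≤ α i) (hα1 : ∀ i, α i < 1)
    (hAstar : IsArgmax G K ε α Astar) (hq : ∀ i, q i = alphaPlus G K ε α Astar i) (hδ0 : 0 < δ)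
    (hδ : ∀ i, δ < (q i - α i) / 2) :
    ∃ t₀, ∀ t ≥ t₀, ∀ T ≥ t, ∀ (A : ℕ → Finset (Fin N)) (z : ℕ → Fin N → Bool),
      (∀ s ∈ Finset.Icc 1 T, IsArgmax G K ε (index c A z s) (A s)) →
      0 < gap G ε α Astar (A t) →
      (∃ j ∈ A t, counts A z j (t - 1) ∈ pullSet (α j) (q j) c (level c T)) ∨
        ∃ i, ∃ s ≤ T, counts A z i s ∈ visitSet (α i) (q i) δ N t := by
  have hNR : (0 : ℝ) < N := by exact_mod_cast hN
  have haq : ∀ i, α i < q i := fun i => by linarith [hδ i]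
  have hq1 : ∀ i, q i ≤ 1 := fun i => by rw [hq i]; exact alphaPlus_le_one i
  have hμ : ∀ i, 0 < klReal (α i) ((α i + q i) / 2) := fun i =>
    klReal_pos (hα0 i) (by linarith [haq i]) (by linarith [hα1 i, hq1 i])
  have e1 : ∀ᶠ t : ℕ in Filter.atTop, ∀ i, (1 + c) * Real.log t
      < klReal (α i) ((α i + q i) / 2) / 2 / (8 * N) * t :=
    Filter.eventually_all.2 fun i => eventually_mul_log_lt (by have := hμ i; positivity)
  have e2 := eventually_mul_sqrt_add_lt (b := 5 / 8) (C := 2 ^ N) (D := N + 1) (by norm_num)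
  have e3 : ∀ᶠ t : ℕ in Filter.atTop, ∀ i, 2 * (t : ℝ) ^ (-1 / 8 : ℝ) < (q i - α i) / 2 :=
    Filter.eventually_all.2 fun i => eventually_mul_rpow_neg_le (by linarith [haq i])
  have e4 : ∀ᶠ t : ℕ in Filter.atTop, ∀ i, 4 * (1 + c) / klReal (α i) ((α i + q i) / 2)
      / (1 - q i) * Real.log t * (t : ℝ) ^ (-1 / 8 : ℝ) < 1 :=
    Filter.eventually_all.2 fun i => eventually_mul_log_mul_rpow_neg_le one_pos
  have e5 := eventually_mul_rpow_neg_le (b := 1) (C := 4) one_pos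
  -- With `η = t ^ (-1/8)`, `log (1 / (4 * η)) = log t / 8 - log 4`, which is at least `log t / 16`
  -- from here on.
  have e6 := eventually_lt_log (16 * Real.log 4)
  have e7 : ∀ᶠ t : ℕ in Filter.atTop, ∀ i, 32 * Real.log 2 / (1 - α i) < Real.log t :=
    Filter.eventually_all.2 fun i => eventually_lt_log _
  obtain ⟨t₀, ht₀⟩ := Filter.eventually_atTop.1
    ((Filter.eventually_ge_atTop 16).and (e1.and (e2.and (e3.and (e4.and (e5.and (e6.and e7)))))))
  refine ⟨t₀, fun t ht T hT A z hA hgap => ?_⟩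
  obtain ⟨h0, h1, h2, h3, h4, h5, h6, h7⟩ := ht₀ t ht
  have htpos : (0 : ℝ) < t := by exact_mod_cast (by omega : 0 < t)
  refine exists_mem_pullSet_or_visitSet hε hK hc hα0 hα1 hAstar hq hδ0 hδ h0 hT (fun i => ?_)
    (by linarith) rfl (fun i => (h3 i).le) (fun i _ => ?_) h5 ?_ (fun i => ?_) hA hgap
  · refine (h1 i).trans_eq ?_
    field_simp
  · refine le_trans (le_of_eq ?_) (h4 i).le
    ring
  · rw [one_div, Real.log_inv, Real.log_mul (by norm_num) (Real.rpow_pos_of_pos htpos _).ne',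
      Real.log_rpow htpos]
    linarith
  · have := h7 i
    rw [div_lt_iff₀ (by linarith [hα1 i])] at this
    linarith

lemma ofReal_gap_le_maxGap {S : Finset (Fin N)} (hS : S ∈ actions N K) :
    ENNReal.ofReal (gap G ε α Astar S) ≤ maxGap G K ε α Astar :=
  le_iSup₂ (f := fun S (_ : S ∈ actions N K) => ENNReal.ofReal (gap G ε α Astar S)) S hS

lemma maxGap_lt_top : maxGap G K ε α Astar < ⊤ := by
  refine lt_of_le_of_lt (b := ∑ S ∈ actions N K, ENNReal.ofReal (gap G ε α Astar S)) ?_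
    (ENNReal.sum_lt_top.2 fun _ _ => ENNReal.ofReal_lt_top)
  exact iSup₂_le fun S hS =>
    Finset.single_le_sum (f := fun S => ENNReal.ofReal (gap G ε α Astar S))
      (fun _ _ => zero_le) hS

lemma ofReal_regret_le {T : ℕ} {A : ℕ → Finset (Fin N)} (hAstar : IsArgmax G K ε α Astar)
    (hA : ∀ t ∈ Finset.Icc 1 T, A t ∈ actions N K) :
    ENNReal.ofReal (regret G ε α Astar T A)
      ≤ ∑ t ∈ Finset.Icc 1 T, ENNReal.ofReal (gap G ε α Astar (A t)) := by
  unfold regret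
  rw [ENNReal.ofReal_sum_of_nonneg fun t ht => gap_nonneg hAstar (hA t ht)]

/-- The regret along one path, in terms of the occupation of the explaining states. -/
lemma ofReal_regret_le_occ {T t₀ : ℕ} {A : ℕ → Finset (Fin N)} {z : ℕ → Fin N → Bool}
    (hAstar : IsArgmax G K ε α Astar) (hA : ∀ t ∈ Finset.Icc 1 T, A t ∈ actions N K)
    {P : Fin N → Set (ℕ × ℕ)} {V : Fin N → ℕ → Set (ℕ × ℕ)}
    (h : ∀ t ∈ Finset.Icc 1 T, t₀ ≤ t → 0 < gap G ε α Astar (A t) →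
      (∃ j ∈ A t, counts A z j (t - 1) ∈ P j) ∨ ∃ i, ∃ s ≤ T, counts A z i s ∈ V i t) :
    ENNReal.ofReal (regret G ε α Astar T A) ≤ maxGap G K ε α Astar *
      (t₀ + ∑ i, occ A z i ((P i).indicator 1) T
        + ∑ t ∈ Finset.Icc 1 T, ∑ i, occ A z i ((V i t).indicator 1) T) := by
  classical
  have hround : ∀ t ∈ Finset.Icc 1 T, ENNReal.ofReal (gap G ε α Astar (A t))
      ≤ maxGap G K ε α Astar * ((if t < t₀ then 1 else 0)
        + ∑ i, (if i ∈ A t then (P i).indicator 1 (counts A z i (t - 1)) else 0)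
        + ∑ i, occ A z i ((V i t).indicator 1) T) := by
    intro t ht
    rcases (gap_nonneg hAstar (hA t ht)).eq_or_lt with h0 | h0
    · simp [← h0]
    refine (ofReal_gap_le_maxGap (hA t ht)).trans (le_mul_of_one_le_right zero_le ?_)
    by_cases ht0 : t < t₀
    · rw [if_pos ht0, add_assoc]
      exact le_self_add
    rcases h t ht (not_lt.1 ht0) h0 with ⟨j, hj, hjP⟩ | ⟨i, s, hs, hiV⟩
    · have : (1 : ℝ≥0∞) ≤ ∑ i, (if i ∈ A t then (P i).indicator 1 (counts A z i (t - 1)) else 0) := by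
        refine le_trans ?_ (Finset.single_le_sum (f := fun i => if i ∈ A t then
          (P i).indicator 1 (counts A z i (t - 1)) else (0 : ℝ≥0∞)) (fun _ _ => zero_le)
          (Finset.mem_univ j))
        simp [hj, hjP]
      exact this.trans (le_add_self.trans le_self_add)
    · have : (1 : ℝ≥0∞) ≤ ∑ i, occ A z i ((V i t).indicator 1) T := by
        refine le_trans ?_ (Finset.single_le_sum (f := fun i => occ A z i ((V i t).indicator 1) T)
          (fun _ _ => zero_le) (Finset.mem_univ i))
        refine le_trans ?_ (le_occ A z i _ hs)
        simp [hiV]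
      exact this.trans le_add_self
  refine (ofReal_regret_le hAstar hA).trans ((Finset.sum_le_sum hround).trans ?_)
  rw [← Finset.mul_sum, Finset.sum_add_distrib, Finset.sum_add_distrib]
  gcongr
  · rw [← Finset.sum_filter, Finset.sum_const, nsmul_eq_mul, mul_one]
    have : {t ∈ Finset.Icc 1 T | t < t₀} ⊆ Finset.range t₀ := fun t ht => by
      simp only [Finset.mem_filter, Finset.mem_range] at ht ⊢
      exact ht.2
    have := Finset.card_le_card this
    rw [Finset.card_range] at this
    exact_mod_cast this
  · rw [Finset.sum_comm]
    exact Finset.sum_le_sum fun i _ => sum_pulls_le_occ A z i _ T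

/-- The expected regret, in terms of bounds on the occupation of the explaining states. -/
lemma IsRun.lintegral_regret_le {Ω : Type*} [mΩ : MeasurableSpace Ω] {μ : Measure Ω}
    [IsProbabilityMeasure μ] {ℱ : Filtration ℕ mΩ} {T t₀ : ℕ} {z : ℕ → Fin N → Ω → Bool}
    {A : ℕ → Ω → Finset (Fin N)} (hrun : IsRun μ ℱ G K ε c α T z A)
    (hα : ∀ i, α i ∈ Set.Icc (0 : ℝ) 1) (hAstar : IsArgmax G K ε α Astar)
    {P : Fin N → Set (ℕ × ℕ)} {V : Fin N → ℕ → Set (ℕ × ℕ)} {p : Fin N → ℝ≥0∞}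
    {b : Fin N → ℕ → ℝ≥0∞}
    (h : ∀ ω, ∀ t ∈ Finset.Icc 1 T, t₀ ≤ t → 0 < gap G ε α Astar (A t ω) →
      (∃ j ∈ A t ω, counts (fun s => A s ω) (fun s i => z s i ω) j (t - 1) ∈ P j) ∨
        ∃ i, ∃ s ≤ T, counts (fun s => A s ω) (fun s i => z s i ω) i s ∈ V i t)
    (hP : ∀ i, OccBound (α i) ((P i).indicator 1) (p i))
    (hV : ∀ i, ∀ t ≥ 1, OccBound (α i) ((V i t).indicator 1) (b i t)) :
    ∫⁻ ω, ENNReal.ofReal (regret G ε α Astar T (fun t => A t ω)) ∂μ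
      ≤ maxGap G K ε α Astar * (t₀ + ∑ i, p i + ∑ i, ∑' t, b i t) := by
  have hmP : ∀ i, Measurable fun ω =>
      occ (fun s => A s ω) (fun s i => z s i ω) i ((P i).indicator 1) T :=
    fun i => hrun.measurable_occ i _
  have hmV : ∀ i t, Measurable fun ω =>
      occ (fun s => A s ω) (fun s i => z s i ω) i ((V i t).indicator 1) T :=
    fun i t => hrun.measurable_occ i _
  have hmS : Measurable fun ω => (t₀ : ℝ≥0∞)
      + ∑ i, occ (fun s => A s ω) (fun s i => z s i ω) i ((P i).indicator 1) T :=
    measurable_const.add (Finset.measurable_fun_sum _ fun i _ => hmP i)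
  refine (lintegral_mono fun ω => ofReal_regret_le_occ hAstar
    (fun t ht => (hrun.optimistic t ht ω).1) (h ω)).trans ?_
  rw [lintegral_const_mul' _ _ maxGap_lt_top.ne]
  gcongr
  rw [lintegral_add_left hmS,
    lintegral_add_left measurable_const, lintegral_const, measure_univ, mul_one,
    lintegral_finsetSum _ fun i _ => hmP i,
    lintegral_finsetSum _ fun t _ => Finset.measurable_fun_sum _ fun i _ => hmV i t]
  gcongr with i
  · exact hrun.lintegral_occ_le (hα i) (hP i)
  · simp_rw [lintegral_finsetSum _ fun i _ => hmV i _]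
    rw [Finset.sum_comm]
    gcongr with i
    refine le_trans (Finset.sum_le_sum fun t ht => ?_) (ENNReal.sum_le_tsum (Finset.Icc 1 T))
    exact hrun.lintegral_occ_le (hα i) (hV i t (Finset.mem_Icc.1 ht).1)

lemma sum_level_div_klBer_eq_top (hc : 0 ≤ c) {i : Fin N}
    (hi : α i = 1) {T : ℕ} (hT : 3 ≤ T) :
    ∑ i, ENNReal.ofReal (level c T) / klBer (α i) (alphaPlus G K ε α Astar i) = ⊤ := by
  have hplus : alphaPlus G K ε α Astar i = 1 := by
    unfold alphaPlus
    rw [hi, ENNReal.ofReal_one, min_eq_left le_self_add, ENNReal.toReal_one]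
  refine ENNReal.sum_eq_top.2 ⟨i, Finset.mem_univ i, ?_⟩
  rw [hplus, hi, klBer_self]
  refine ENNReal.div_zero (ENNReal.ofReal_pos.2 ?_).ne'
  linarith [one_lt_log hT, log_le_level hc hT]

end Regret

end ProbDPP

theorem theorem4p1 {N K : ℕ} (hK : 1 ≤ K)
    (G : Matrix (Fin N) (Fin N) ℝ) (hG : G.PosSemidef)
    (hGpos : ∀ S ∈ ProbDPP.actions N K, (ProbDPP.principal G S).PosDef)
    (ε c : ℝ) (hε : 0 < ε) (hc : 0 < c)
    (α : Fin N → ℝ) (hα : ∀ i, α i ∈ Set.Icc (0 : ℝ) 1)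
    (Astar : Finset (Fin N)) (hAstar : ProbDPP.IsArgmax G K ε α Astar) :
    ProbDPP.maxGap G K ε α Astar < ⊤ ∧
    ∃ C : ℝ≥0, ∀ T : ℕ, 3 ≤ T →
      ∀ (Ω : Type*) [mΩ : MeasurableSpace Ω] (μ : Measure Ω) [IsProbabilityMeasure μ]
        (ℱ : Filtration ℕ mΩ)
        (z : ℕ → Fin N → Ω → Bool) (A : ℕ → Ω → Finset (Fin N)),
        ProbDPP.IsRun μ ℱ G K ε c α T z A →
        ∫⁻ ω, ENNReal.ofReal (ProbDPP.regret G ε α Astar T (fun t => A t ω)) ∂μ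
          ≤ ProbDPP.maxGap G K ε α Astar *
              ∑ i, ENNReal.ofReal (ProbDPP.level c T) /
                ProbDPP.klBer (α i) (ProbDPP.alphaPlus G K ε α Astar i)
            + C := by
  open ProbDPP in
  refine ⟨maxGap_lt_top, ?_⟩
  by_cases hα1 : ∀ i, α i < 1
  swap
  -- If some `α i = 1`, the denominator of that item is 0 and the bound is infinite, unless `maxGap
  -- = 0`, in which case there is no regret.
  · push Not at hα1
    obtain ⟨i, hi⟩ := hα1
    refine ⟨0, fun T hT Ω _ μ _ ℱ z A hrun => ?_⟩
    by_cases hmax : maxGap G K ε α Astar = 0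
    · refine le_trans (le_of_eq ?_) zero_le
      rw [lintegral_eq_zero_of_ae_eq_zero]
      refine Filter.Eventually.of_forall fun ω => ?_
      refine le_antisymm ((ofReal_regret_le hAstar fun t ht => (hrun.optimistic t ht ω).1).trans ?_)
        zero_le
      refine (Finset.sum_nonpos fun t ht => ?_)
      rw [← hmax]
      exact ofReal_gap_le_maxGap (hrun.optimistic t ht ω).1
    · rw [sum_level_div_klBer_eq_top hc.le (le_antisymm (hα i).2 hi) hT, ENNReal.mul_top hmax,
        top_add]
      exact le_top
  have hα0 : ∀ i, 0 ≤ α i := fun i => (hα i).1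
  have hN : 0 < N := by
    have h1 := (Finset.mem_powersetCard.1 hAstar.1).2
    have h2 := Finset.card_le_univ Astar
    rw [Fintype.card_fin] at h2
    omega
  set q : Fin N → ℝ := fun i => alphaPlus G K ε α Astar i with hq
  have haq : ∀ i, α i < q i := fun i => lt_alphaPlus (hα0 i) (hα1 i)
  have hq1 : ∀ i, q i ≤ 1 := fun i => alphaPlus_le_one i
  obtain ⟨δ, hδ0, hδ⟩ : ∃ δ > 0, ∀ i, δ < (q i - α i) / 2 := by
    have : Nonempty (Fin N) := ⟨⟨0, hN⟩⟩
    obtain ⟨i₀, hi₀⟩ := Finite.exists_min fun i => q i - α i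
    refine ⟨(q i₀ - α i₀) / 4, by linarith [haq i₀], fun i => ?_⟩
    linarith [hi₀ i, haq i₀]
  obtain ⟨t₀, hexplain⟩ := exists_forall_mem_pullSet_or_visitSet hε hK hc.le hN hα0 hα1 hAstar
    (fun i => rfl) hδ0 hδ
  choose D hD using fun i => occBound_pullSet (c := c) (hα0 i) (hα1 i) (haq i) (hq1 i)
  choose b hb hV using fun i => occBound_visitSet hN (hα0 i) (hα1 i) (haq i) (hq1 i) hδ0
  -- The additive constant collects the first `t₀` rounds, the bounded excess of the charged pulls
  -- over the leading term, and the unlikely visits summed over all `t`. None of these depends on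
  -- `T`.
  set R : ℝ≥0∞ := maxGap G K ε α Astar * (t₀ + ∑ i, ENNReal.ofReal (D i) + ∑ i, ∑' t, b i t) with hR
  have hRtop : R ≠ ⊤ := by
    refine ENNReal.mul_ne_top maxGap_lt_top.ne (ENNReal.add_ne_top.2 ⟨ENNReal.add_ne_top.2
      ⟨ENNReal.natCast_ne_top _, ?_⟩, ?_⟩)
    · exact (ENNReal.sum_lt_top.2 fun _ _ => ENNReal.ofReal_lt_top).ne
    · exact (ENNReal.sum_lt_top.2 fun i _ => (hb i).lt_top).ne
  refine ⟨R.toNNReal, fun T hT Ω _ μ _ ℱ z A hrun => ?_⟩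
  have hlevel : 0 ≤ level c T := by linarith [one_lt_log hT, log_le_level hc.le hT]
  refine (hrun.lintegral_regret_le hα hAstar (fun ω t ht htt₀ hgap => hexplain t htt₀ T
    (Finset.mem_Icc.1 ht).2 _ _ (fun s hs => hrun.optimistic s hs ω) hgap)
    (fun i => hD i _ hlevel) hV).trans (le_of_eq ?_)
  rw [ENNReal.coe_toNNReal hRtop, hR, Finset.sum_add_distrib, ← mul_add]
  congr 1
  ring
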